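/- \textbf{The algorithm.} Asynchronous processes, which may crash, execute the following code atomically line by line on shared memory. A node has fields $\mathit{value}\in\mathbb Z$, $\mathit{next}$ (a pointer to a node or $\mathrm{NULL}$), $\mathit{flag}\in\{0,1\}$; a location holds $\mathrm{NULL}$, $\bot$ or an integer; freshly allocated nodes and locations have never been allocated before and have arbitrary contents. Shared objects: $g\_Tail$ and $g\_Ann\_E$ (pointers to nodes), $g\_Head=(\mathit{ptr},\mathit{value},\mathit{addr})$ (a pointer to a node, a value, a pointer to a location), $g\_Ann\_D$ (a pointer to a location). Initially $g\_Tail$, $g\_Head.\mathit{ptr}$, $g\_Ann\_E$ point to a node with $\mathit{next}=\mathrm{NULL}$, $\mathit{flag}=1$; $g\_Head.\mathit{addr}$ and $g\_Ann\_D$ point to a location with non-$\mathrm{NULL}$ contents; $g\_Head.\mathit{value}\neq\mathrm{NULL}$. $\mathrm{CAS}(a,b)$ on an object atomically replaces its value by $b$ and returns true if its value is $a$, and otherwise returns false. \begin{itemize} \item $\mathrm{enqueue}(v)$, $v\in\mathbb Z$: $l\_Ann\_E:=g\_Ann\_E$; $\mathrm{trytoenqueue}(l\_Ann\_E)$; $l\_Node:=$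 a new node; $l\_Node\to value:=v$; $l\_Node\to next:=\mathrm{NULL}$; $l\_Node\to flag:=0$; while $\mathrm{trytoenqueue}(l\_Node)=\mathbf{failed}$ do $g\_Ann\_E:=l\_Node$; return $\mathbf{done}$. \item $\mathrm{dequeue}()$: $l\_Ann\_D:=g\_Ann\_D$; if $*l\_Ann\_D=\mathrm{NULL}$ then $\mathrm{trytodequeue}(l\_Ann\_D)$; $l\_addr:=$ a pointer to a new location; $*l\_addr:=\mathrm{NULL}$; repeat [$t:=\mathrm{trytodequeue}(l\_addr)$; if $t=\mathbf{failed}$ then $g\_Ann\_D:=l\_addr$] until $t\neq\mathbf{failed}$; return $t$. \item $\mathrm{trytoenqueue}(n)$: $l\_Tail:=g\_Tail$; $l\_next:=l\_Tail\to next$; if $n\to flag=1$ then [$l\_Tail:=g\_Tail$; $l\_next:=l\_Tail\to next$; if $l\_next\ne\mathrm{NULL}$ then ($l\_next\to flag:=1$; $g\_Tail.\mathrm{CAS}(l\_Tail,l\_next)$); return $\mathbf{done}$]; if $l\_next\neq\mathrm{NULL}$ then [$l\_next\to flag:=1$; $g\_Tail.\mathrm{CAS}(l\_Tail,l\_next)$]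 else if $(l\_Tail\to next).\mathrm{CAS}(\mathrm{NULL},n)$ then [$n\to flag:=1$; $g\_Tail.\mathrm{CAS}(l\_Tail,n)$; return $\mathbf{done}$]; return $\mathbf{failed}$. \item $\mathrm{trytodequeue}(a)$: $l\_Head:=g\_Head$; $l\_Tail:=g\_Tail$ $(\ast)$; $*(l\_Head.addr):=l\_Head.value$; if $*a\neq\mathrm{NULL}$ then return $*a$ (read again); if $l\_Head.ptr=l\_Tail$ then [if $g\_Head.\mathrm{CAS}(l\_Head,(l\_Head.ptr,\bot,a))$ then return $\bot$] else [$l\_next:=l\_Head.ptr\to next$; $w:=l\_next\to value$; if $g\_Head.\mathrm{CAS}(l\_Head,(l\_next,w,a))$ then return $w$]; return $\mathbf{failed}$. \end{itemize} \textbf{Theorem.} The algorithm is a linearizable implementation of an initially empty FIFO queue of integers, in which a dequeue of an empty queue returns $\bot$. More precisely, let $H$ be the history of any finite or infinite execution. Let $H'$ be obtained from $H$ as follows. An incomplete enqueue that has allocated its new node $l\_Node$ is completed by the response $\mathbf{done}$ if $g\_Tail$ has pointed to this node. An incomplete dequeue that has allocated its new location $l\_addr$ is completed, if $g\_Head.\mathit{addr}$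 has pointed to this location, by returning the value of $g\_Head.\mathit{value}$ at the earliest such time. All other incomplete operations are removed. Linearize each enqueue of $H'$ when $g\_Tail$ first points to the new node it allocates; each dequeue of $H'$ that returns a value other than $\bot$ when $g\_Head.\mathit{addr}$ first points to the new location it allocates; and each dequeue of $H'$ that returns $\bot$ when the process that first makes $g\_Head.\mathit{addr}$ point to that location last reads $g\_Tail$ in line $(\ast)$ before doing so. Then $H'$ is a completion of $H$; every operation of $H'$ has exactly one linearization point, which lies after its invocation and before its response in $H$ (if it has one); distinct operations of $H'$ have distinct linearization points; and the sequence $L$ of the operations of $H'$ in the order of their linearization points is a linearization of $H'$: it contains each operation of $H'$ exactly once, respects the real-time order of $H$, and (each finite initial segment of it) respects the sequential specification of the queue. -/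

import Mathlib

namespace DNB2Queue

/-! ## Histories, the sequential queue, linearizability -/

/-- Operations of a queue of integers. -/
inductive Op where
  | enq (v : ℤ)
  | deq

/-- Contents of a location: `NULL`, the special value `⊥` (empty queue), or an integer. -/
inductive Cell where
  | null
  | bot
  | elem (v : ℤ)
  deriving DecidableEq

/-- Responses: `done` (from an enqueue) or a returned value (from a dequeue). -/
inductive Resp where
  | done
  | ret (x : Cell)
  deriving DecidableEq

/-- The events visible at the interface of the implemented object. -/
inductive Event where
  | inv (op : Op)
  | res (r : Resp)

/-- Sequential specification of a FIFO queue: new state and response. -/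
def applyOp : Op → List ℤ → List ℤ × Resp
  | .enq v, q => (q ++ [v], .done)
  | .deq, [] => ([], .ret .bot)
  | .deq, x :: q => (q, .ret (.elem x))

/-- `Legal q l`: the sequential history `l` is allowed by the FIFO specification from state `q`. -/
def Legal : List ℤ → List (Op × Resp) → Prop
  | _, [] => True
  | q, (op, r) :: l => (applyOp op q).2 = r ∧ Legal (applyOp op q).1 l

/-- A finite or infinite history: at each time, at most one event of one process. -/
abbrev History (P : Type*) := ℕ → Option (P × Event)

/-- The operation that `p` invoked at time `i` has received no response strictly before time `k`,
and `k` is after the invocation. -/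
def History.Open {P : Type*} (H : History P) (i : ℕ) (p : P) (k : ℕ) : Prop :=
  i < k ∧ ∀ m, i < m → m < k → ∀ r, H m ≠ some (p, .res r)

/-- The operation that `p` invoked at time `i` receives response `r` at time `j`. -/
def History.RespondsAt {P : Type*} (H : History P) (i : ℕ) (p : P) (r : Resp) (j : ℕ) : Prop :=
  H.Open i p j ∧ H j = some (p, .res r)

/-- A completed operation instance: the time of its invocation (which identifies it), the process
that invoked it, the operation, and the response. -/
structure OpRec (P : Type*) where
  inv : ℕ
  proc : P
  op : Op
  resp : Resp

/-- `K` (a set of completed operations) is a completion of `H`: every operation that has a response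
in `H` occurs with this response; some of the other invoked operations are given a response,
and the rest are removed. -/
structure IsCompletion {P : Type*} (H : History P) (K : Set (OpRec P)) : Prop where
  invoked : ∀ o ∈ K, H o.inv = some (o.proc, .inv o.op)
  unique : ∀ o ∈ K, ∀ o' ∈ K, o.inv = o'.inv → o = o'
  response : ∀ o ∈ K, ∀ r j, H.RespondsAt o.inv o.proc r j → o.resp = r
  completed : ∀ i p op r j, H i = some (p, .inv op) → H.RespondsAt i p r j →
    (⟨i, p, op, r⟩ : OpRec P) ∈ K

/-- The first operations of a sequence of operations, up to position `N`. A sequence may be finite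
or infinite: positions may be blank. -/
def firstOps {P : Type*} (L : ℕ → Option (OpRec P)) (N : ℕ) : List (Op × Resp) :=
  (List.range N).filterMap fun t => (L t).map fun o => (o.op, o.resp)

/-- The sequence `L` is a linearization of the completion `K` of `H`: it consists of exactly the
operations of `K`, each once; it respects the real-time order of `H`; and it is legal for a
FIFO queue that is initially empty. -/
structure IsLinearization {P : Type*} (H : History P) (K : Set (OpRec P))
    (L : ℕ → Option (OpRec P)) : Prop where
  mem : ∀ t o, L t = some o → o ∈ K
  once : ∀ o ∈ K, ∃! t, L t = some o
  realTime : ∀ o o' t t' r j, L t = some o → L t' = some o' →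
    H.RespondsAt o.inv o.proc r j → j < o'.inv → t < t'
  legal : ∀ N, Legal [] (firstOps L N)

/-- Linearizability of a history with respect to the FIFO queue. -/
def Linearizable {P : Type*} (H : History P) : Prop :=
  ∃ K L, IsCompletion H K ∧ IsLinearization H K L

/-! ## The shared memory and the code -/

/-- Pointers to nodes; `none` is `NULL`. -/
abbrev NodePtr := Option ℕ

/-- Pointers to locations. -/
abbrev LocPtr := ℕ

structure Node where
  value : ℤ
  next : NodePtr
  flag : Bool

/-- The contents of `g_Head`. -/
structure Head where
  ptr : NodePtr
  value : Cell
  addr : LocPtr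
  deriving DecidableEq

/-- The shared objects. The sets `usedNodes`, `usedLocs` record what has been allocated. -/
structure Shared where
  node : NodePtr → Node
  cell : LocPtr → Cell
  usedNodes : Set NodePtr
  usedLocs : Set LocPtr
  tail : NodePtr
  head : Head
  annE : NodePtr
  annD : LocPtr

/-- Program lines:
```
enqueue(v)
  e1   l_Ann_E := g_Ann_E.read()
  e2   trytoenqueue(l_Ann_E)
  e3   l_Node := a new node
  e4   l_Node->value.write(v)
  e5   l_Node->next.write(NULL)
  e6   l_Node->flag.write(0)
  e7   while trytoenqueue(l_Node) = failed
  e8     g_Ann_E.write(l_Node)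
  e9   return done

dequeue()
  d1   l_Ann_D := g_Ann_D.read()
  d2   if *l_Ann_D.read() = NULL
  d3     trytodequeue(l_Ann_D)
  d4   l_addr := a pointer to a new location
  d5   *l_addr.write(NULL)
  d6   repeat t := trytodequeue(l_addr)
  d7     if t = failed then g_Ann_D := l_addr
       until t is not failed
  d8   return t

trytoenqueue(l_Node)
  te1   l_Tail := g_Tail.read()
  te2   l_next := l_Tail->next.read()
  te3   if l_Node->flag.read() = 1
  te4     l_Tail := g_Tail.read()
  te5     l_next := l_Tail->next.read()
  te6     if l_next is not NULL
  te7       l_next->flag.write(1)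
  te8       g_Tail.CAS(l_Tail, l_next)
  te9     return done
  te10  if l_next is not NULL
  te11    l_next->flag.write(1)
  te12    g_Tail.CAS(l_Tail, l_next)
  te13  else if l_Tail->next.CAS(NULL, l_Node)
  te14    l_Node->flag.write(1)
  te15    g_Tail.CAS(l_Tail, l_Node)
  te16    return done
  te17  return failed

trytodequeue(l_addr)
  td1   l_Head := g_Head.read()
  td2   l_Tail := g_Tail.read()
  td3   *(l_Head.addr).write(l_Head.value)
  td4   if *l_addr.read() is not NULL
  td5     return *l_addr.read()
  td6   if l_Head.ptr = l_Tail
  td7     if g_Head.CAS(l_Head, (l_Head.ptr, bot, l_addr))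
  td8       return bot
        else
  td9     l_next := l_Head.ptr->next.read()
  td10    v := l_next->value.read()
  td11    if g_Head.CAS(l_Head, (l_next, v, l_addr))
  td12      return v
  td13  return failed
```
`idle` means that the process is not executing an operation. -/
inductive Line where
  | idle
  | e1 | e2 | e3 | e4 | e5 | e6 | e7 | e8 | e9
  | d1 | d2 | d3 | d4 | d5 | d6 | d7 | d8
  | te1 | te2 | te3 | te4 | te5 | te6 | te7 | te8 | te9 | te10 | te11 | te12 | te13 | te14
  | te15 | te16 | te17
  | td1 | td2 | td3 | td4 | td5 | td6 | td7 | td8 | td9 | td10 | td11 | td12 | td13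
  deriving DecidableEq

/-- Local variables of a process. `argNode` and `argAddr` are the parameters of `trytoenqueue` and
`trytodequeue`; `selfish` tells whether these were called to perform the caller's own operation
(lines `e7`, `d6`) or to help (lines `e2`, `d3`), that is, where to return. -/
structure Locals where
  pc : Line
  v : ℤ
  annE : NodePtr
  lnode : NodePtr
  annD : LocPtr
  addr : LocPtr
  t : Cell
  selfish : Bool
  argNode : NodePtr
  argAddr : LocPtr
  tail : NodePtr
  next : NodePtr
  head : Head
  w : ℤ

namespace Shared

def setValue (s : Shared) (n : NodePtr) (v : ℤ) : Shared :=
  { s with node := Function.update s.node n { s.node n with value := v } }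

def setNext (s : Shared) (n m : NodePtr) : Shared :=
  { s with node := Function.update s.node n { s.node n with next := m } }

def setFlag (s : Shared) (n : NodePtr) (b : Bool) : Shared :=
  { s with node := Function.update s.node n { s.node n with flag := b } }

def setCell (s : Shared) (a : LocPtr) (x : Cell) : Shared :=
  { s with cell := Function.update s.cell a x }

/-- `g_Tail.CAS(old, new)` -/
def casTail (s : Shared) (old new : NodePtr) : Shared :=
  if s.tail = old then { s with tail := new } else s

/-- `n->next.CAS(NULL, new)` -/
def casNext (s : Shared) (n new : NodePtr) : Shared :=
  if (s.node n).next = none then s.setNext n new else s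

/-- `g_Head.CAS(old, new)` -/
def casHead (s : Shared) (old new : Head) : Shared :=
  if s.head = old then { s with head := new } else s

end Shared

namespace Locals

/-- Continuation of `trytoenqueue` returning `done`. -/
def enqDone (l : Locals) : Locals := { l with pc := if l.selfish then .e9 else .e3 }

/-- Continuation of `trytoenqueue` returning `failed`. -/
def enqFailed (l : Locals) : Locals := { l with pc := if l.selfish then .e8 else .e3 }

/-- Continuation of `trytodequeue` returning `x`; the result is ignored when helping. -/
def deqReturn (l : Locals) (x : Cell) : Locals :=
  if l.selfish then { l with pc := .d8, t := x } else { l with pc := .d4 }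

/-- Continuation of `trytodequeue` returning `failed`. -/
def deqFailed (l : Locals) : Locals := { l with pc := if l.selfish then .d7 else .d4 }

end Locals

/-- One atomic step of a process: `LStep s l e s' l'` says that from shared state `s` and
local state `l` the process can execute its current line, with interface event `e` (if any),
resulting in `s'` and `l'`. An idle process may invoke any operation. -/
inductive LStep (s : Shared) (l : Locals) : Option Event → Shared → Locals → Prop
  | invEnq (v : ℤ) : l.pc = .idle → LStep s l (some (.inv (.enq v))) s { l with pc := .e1, v := v }
  | invDeq : l.pc = .idle → LStep s l (some (.inv .deq)) s { l with pc := .d1 }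
  -- enqueue
  | e1 : l.pc = .e1 → LStep s l none s { l with pc := .e2, annE := s.annE }
  | e2 : l.pc = .e2 → LStep s l none s { l with pc := .te1, argNode := l.annE, selfish := false }
  | e3 (n : NodePtr) : l.pc = .e3 → n ≠ none → n ∉ s.usedNodes →
      LStep s l none { s with usedNodes := insert n s.usedNodes } { l with pc := .e4, lnode := n }
  | e4 : l.pc = .e4 → LStep s l none (s.setValue l.lnode l.v) { l with pc := .e5 }
  | e5 : l.pc = .e5 → LStep s l none (s.setNext l.lnode none) { l with pc := .e6 }
  | e6 : l.pc = .e6 → LStep s l none (s.setFlag l.lnode false) { l with pc := .e7 }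
  | e7 : l.pc = .e7 → LStep s l none s { l with pc := .te1, argNode := l.lnode, selfish := true }
  | e8 : l.pc = .e8 → LStep s l none { s with annE := l.lnode } { l with pc := .e7 }
  | e9 : l.pc = .e9 → LStep s l (some (.res .done)) s { l with pc := .idle }
  -- dequeue
  | d1 : l.pc = .d1 → LStep s l none s { l with pc := .d2, annD := s.annD }
  | d2 : l.pc = .d2 → LStep s l none s
      { l with pc := if s.cell l.annD = .null then .d3 else .d4 }
  | d3 : l.pc = .d3 → LStep s l none s { l with pc := .td1, argAddr := l.annD, selfish := false }
  | d4 (a : LocPtr) : l.pc = .d4 → a ∉ s.usedLocs →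
      LStep s l none { s with usedLocs := insert a s.usedLocs } { l with pc := .d5, addr := a }
  | d5 : l.pc = .d5 → LStep s l none (s.setCell l.addr .null) { l with pc := .d6 }
  | d6 : l.pc = .d6 → LStep s l none s { l with pc := .td1, argAddr := l.addr, selfish := true }
  | d7 : l.pc = .d7 → LStep s l none { s with annD := l.addr } { l with pc := .d6 }
  | d8 : l.pc = .d8 → LStep s l (some (.res (.ret l.t))) s { l with pc := .idle }
  -- trytoenqueue
  | te1 : l.pc = .te1 → LStep s l none s { l with pc := .te2, tail := s.tail }
  | te2 : l.pc = .te2 → LStep s l none s { l with pc := .te3, next := (s.node l.tail).next }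
  | te3 : l.pc = .te3 → LStep s l none s
      { l with pc := if (s.node l.argNode).flag = true then .te4 else .te10 }
  | te4 : l.pc = .te4 → LStep s l none s { l with pc := .te5, tail := s.tail }
  | te5 : l.pc = .te5 → LStep s l none s { l with pc := .te6, next := (s.node l.tail).next }
  | te6 : l.pc = .te6 → LStep s l none s { l with pc := if l.next ≠ none then .te7 else .te9 }
  | te7 : l.pc = .te7 → LStep s l none (s.setFlag l.next true) { l with pc := .te8 }
  | te8 : l.pc = .te8 → LStep s l none (s.casTail l.tail l.next) { l with pc := .te9 }
  | te9 : l.pc = .te9 → LStep s l none s l.enqDone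
  | te10 : l.pc = .te10 → LStep s l none s { l with pc := if l.next ≠ none then .te11 else .te13 }
  | te11 : l.pc = .te11 → LStep s l none (s.setFlag l.next true) { l with pc := .te12 }
  | te12 : l.pc = .te12 → LStep s l none (s.casTail l.tail l.next) { l with pc := .te17 }
  | te13 : l.pc = .te13 → LStep s l none (s.casNext l.tail l.argNode)
      { l with pc := if (s.node l.tail).next = none then .te14 else .te17 }
  | te14 : l.pc = .te14 → LStep s l none (s.setFlag l.argNode true) { l with pc := .te15 }
  | te15 : l.pc = .te15 → LStep s l none (s.casTail l.tail l.argNode) { l with pc := .te16 }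
  | te16 : l.pc = .te16 → LStep s l none s l.enqDone
  | te17 : l.pc = .te17 → LStep s l none s l.enqFailed
  -- trytodequeue
  | td1 : l.pc = .td1 → LStep s l none s { l with pc := .td2, head := s.head }
  | td2 : l.pc = .td2 → LStep s l none s { l with pc := .td3, tail := s.tail }
  | td3 : l.pc = .td3 → LStep s l none (s.setCell l.head.addr l.head.value) { l with pc := .td4 }
  | td4 : l.pc = .td4 → LStep s l none s
      { l with pc := if s.cell l.argAddr ≠ .null then .td5 else .td6 }
  | td5 : l.pc = .td5 → LStep s l none s (l.deqReturn (s.cell l.argAddr))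
  | td6 : l.pc = .td6 → LStep s l none s
      { l with pc := if l.head.ptr = l.tail then .td7 else .td9 }
  | td7 : l.pc = .td7 → LStep s l none (s.casHead l.head ⟨l.head.ptr, .bot, l.argAddr⟩)
      { l with pc := if s.head = l.head then .td8 else .td13 }
  | td8 : l.pc = .td8 → LStep s l none s (l.deqReturn .bot)
  | td9 : l.pc = .td9 → LStep s l none s { l with pc := .td10, next := (s.node l.head.ptr).next }
  | td10 : l.pc = .td10 → LStep s l none s { l with pc := .td11, w := (s.node l.next).value }
  | td11 : l.pc = .td11 → LStep s l none (s.casHead l.head ⟨l.next, .elem l.w, l.argAddr⟩)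
      { l with pc := if s.head = l.head then .td12 else .td13 }
  | td12 : l.pc = .td12 → LStep s l none s (l.deqReturn (.elem l.w))
  | td13 : l.pc = .td13 → LStep s l none s l.deqFailed

/-- A configuration: the shared state and the local state of every process. -/
structure Config (P : Type*) where
  sh : Shared
  loc : P → Locals

/-- Process `p` takes an atomic step with interface event `e` (if any). -/
def Config.Step {P : Type*} (c : Config P) (p : P) (e : Option Event) (c' : Config P) : Prop :=
  LStep c.sh (c.loc p) e c'.sh (c'.loc p) ∧ ∀ q, q ≠ p → c'.loc q = c.loc q

/-- Initial configurations: `g_Tail`, `g_Head.ptr` and `g_Ann_E` point to `g_Init_Node`, `g_Head.addr`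
and `g_Ann_D` point to `g_Init_DQ`. All contents that are not mentioned are arbitrary. -/
structure Config.Initial {P : Type*} (c : Config P) (initNode : NodePtr) (initDQ : LocPtr) :
    Prop where
  initNode_ne : initNode ≠ none
  initNode_next : (c.sh.node initNode).next = none
  initNode_flag : (c.sh.node initNode).flag = true
  initDQ_ne : c.sh.cell initDQ ≠ .null
  tail : c.sh.tail = initNode
  head_ptr : c.sh.head.ptr = initNode
  head_value : c.sh.head.value ≠ .null
  head_addr : c.sh.head.addr = initDQ
  annE : c.sh.annE = initNode
  annD : c.sh.annD = initDQ
  usedNodes : c.sh.usedNodes = {initNode}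
  usedLocs : c.sh.usedLocs = {initDQ}
  idle : ∀ p, (c.loc p).pc = .idle

/-- A finite or infinite execution of the algorithm by the processes `P`: at each time at most one
process takes a step. When `act t = none` nothing happens at time `t` (a finite execution is one
where nothing happens from some time on). A process may stop taking steps at any time. -/
structure Run (P : Type*) where
  conf : ℕ → Config P
  act : ℕ → Option (P × Option Event)
  init : ∃ initNode initDQ, (conf 0).Initial initNode initDQ
  step : ∀ t p e, act t = some (p, e) → (conf t).Step p e (conf (t + 1))
  stay : ∀ t, act t = none → conf (t + 1) = conf t

/-! ## The completion and the linearization points -/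

namespace Run

variable {P : Type*} (R : Run P)

/-- The history of the execution: its invocations and responses. -/
def history : History P := fun t => (R.act t).bind fun a => a.2.map fun e => (a.1, e)

/-- At time `t`, process `p` takes a step, executing line `ln`. -/
def Executes (t : ℕ) (p : P) (ln : Line) : Prop :=
  (∃ e, R.act t = some (p, e)) ∧ ((R.conf t).loc p).pc = ln

/-- The (enqueue) operation that `p` invoked at time `i` allocates the node `n`. -/
def AllocNode (i : ℕ) (p : P) (n : NodePtr) : Prop :=
  ∃ k, R.history.Open i p k ∧ R.Executes k p .e3 ∧ ((R.conf (k + 1)).loc p).lnode = n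

/-- The (dequeue) operation that `p` invoked at time `i` allocates the location `a`. -/
def AllocLoc (i : ℕ) (p : P) (a : LocPtr) : Prop :=
  ∃ k, R.history.Open i p k ∧ R.Executes k p .d4 ∧ ((R.conf (k + 1)).loc p).addr = a

/-- The step at time `t` makes `g_Tail` point to `n` for the first time. -/
def FirstTail (n : NodePtr) (t : ℕ) : Prop :=
  (R.conf (t + 1)).sh.tail = n ∧ ∀ s ≤ t, (R.conf s).sh.tail ≠ n

/-- The step at time `t` makes `g_Head.addr` point to `a` for the first time. -/
def FirstHead (a : LocPtr) (t : ℕ) : Prop :=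
  (R.conf (t + 1)).sh.head.addr = a ∧ ∀ s ≤ t, (R.conf s).sh.head.addr ≠ a

/-- `t` is the last time before `u` when the process taking the step at time `u` reads `g_Tail` in
`trytodequeue`. -/
def LastTailRead (u t : ℕ) : Prop :=
  ∃ q e, R.act u = some (q, e) ∧ t < u ∧ R.Executes t q .td2 ∧
    ∀ m, t < m → m < u → ¬ R.Executes m q .td2

/-- The response given to an incomplete operation that `p` invoked at time `i`: an enqueue
whose node has been pointed to by `g_Tail` returns `done`; a dequeue whose location has been pointed
to by `g_Head.addr` returns the value of `g_Head.value` at the earliest such time. -/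
def AddedResponse (i : ℕ) (p : P) : Op → Resp → Prop
  | .enq _, r => (∃ n t, R.AllocNode i p n ∧ R.FirstTail n t) ∧ r = .done
  | .deq, r => ∃ a t, R.AllocLoc i p a ∧ R.FirstHead a t ∧ r = .ret (R.conf (t + 1)).sh.head.value

/-- The completion of the history: complete operations keep their response, incomplete ones
are completed by `AddedResponse` if it applies and are removed otherwise. -/
def completion : Set (OpRec P) :=
  { o | R.history o.inv = some (o.proc, .inv o.op) ∧
    ((∃ j, R.history.RespondsAt o.inv o.proc o.resp j) ∨
      ((¬ ∃ r j, R.history.RespondsAt o.inv o.proc r j) ∧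
        R.AddedResponse o.inv o.proc o.op o.resp)) }

/-- `t` is the linearization point of `o`: for an enqueue, when `g_Tail` first points to its node;
for a dequeue that does not return `⊥`, when `g_Head.addr` first points to its location; for a
dequeue that returns `⊥`, when the process that makes `g_Head.addr` first point to its location
last reads `g_Tail` in `trytodequeue`. -/
def LinPoint (o : OpRec P) (t : ℕ) : Prop :=
  match o.op with
  | .enq _ => ∃ n, R.AllocNode o.inv o.proc n ∧ R.FirstTail n t
  | .deq => ∃ a u, R.AllocLoc o.inv o.proc a ∧ R.FirstHead a u ∧
      ((o.resp ≠ .ret .bot ∧ t = u) ∨ (o.resp = .ret .bot ∧ R.LastTailRead u t))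

/-- Time `t` is within the execution interval of `o`: after its invocation and before its response
(if the history contains one). -/
def Within (o : OpRec P) (t : ℕ) : Prop :=
  o.inv < t ∧ ∀ r j, R.history.RespondsAt o.inv o.proc r j → t < j

end Run

end DNB2Queue

open DNB2Queue

/-!
The abstract queue at a time `t` consists of the values of the nodes after `g_Head.ptr`, up to
`g_Tail`. The proof shows that this queue changes exactly at the linearization points, and there
as the specification prescribes.

An invariant on configurations is proved first, with a ghost state that lists the nodes in the
order of their insertion, the positions of `g_Tail` and `g_Head.ptr` in this list, and the
locations that have been `g_Head.addr` with the accompanying values of `g_Head` (`SharedInv`,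
`ProcInv`). It is preserved by every step of the acting process (`SharedInv.step`), and the
assertions about the other processes survive because they only depend on facts that no step
destroys (`Evolves`, `ProcInv.stable`). Three points matter.

* A node is appended at most once. The flag of a node is set before `g_Tail` reaches the node. A
  process that sees flag `0` after it has read `g_Tail` at position `i` knows that the node is not
  at a position up to `i`, and the CAS succeeds only if position `i` is the last one
  (`SharedInv.casNext`).

* A location is served at most once. Before `g_Head` is replaced, its value is written to the
  location `g_Head.addr`. So a process that finds its location still `NULL` after having written
  the value of the `g_Head` that it read knows that the location has not been in `g_Head`, unless
  `g_Head` has changed (`SharedInv.unserved`). As `g_Head.addr` thus never returns to a former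
  value, the CAS on `g_Head` is free of the ABA problem (`SharedInv.casHead`,
  `Run.GhostRun.head_addr_eq`).

* If a CAS installs `⊥`, then `g_Head` did not change since the process read it, and `g_Tail` was
  equal to `g_Head.ptr` at the last reading in line `td2`: the queue was empty at that time
  (`Run.FirstHead.exists_tailRead`).

Operations are matched with nodes and locations through the invariant `Run.OpInv`: a busy process
has exactly one open operation, which allocates at most once. A response is only given after the
node has been reached by `g_Tail`, or the location by `g_Head.addr`, which gives the completion
and the position of the linearization points within the operations. Each step that moves `g_Tail`
or changes `g_Head` to a value other than `⊥` is conversely the linearization point of the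
operation that allocated the node or location (`Run.GhostRun.queueAt_succ`).
-/

namespace DNB2Queue

/-! ### The ghost state and its invariant -/

/-- Auxiliary state that the proof adds to the shared memory.
`nodeAt 0, …, nodeAt (len - 1)` are the nodes of the linked list in the order of their insertion
(and `nodeAt i = NULL` beyond); `tailPos` and `headPos` are the positions of `g_Tail` and
`g_Head.ptr`. A node or location is *ready* when its creator has initialized it. `owner` records
which process allocated a node, and for which value; `ownerLoc` which process allocated a location.
`val a` is the value that `g_Head` had when `g_Head.addr` first was `a` (if it has been `a`), and
`initLoc` is the location that `g_Head.addr` points to initially. -/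
structure Ghost (P : Type*) where
  nodeAt : ℕ → NodePtr
  len : ℕ
  tailPos : ℕ
  headPos : ℕ
  ready : Set NodePtr
  owner : NodePtr → Option (P × ℤ)
  readyLoc : Set LocPtr
  ownerLoc : LocPtr → Option P
  val : LocPtr → Option Cell
  initLoc : LocPtr

/-- The invariant of the shared memory. The only ready location that may hold a value different from
`NULL` and from its `val` is `initLoc`, whose initial contents are arbitrary. -/
structure SharedInv {P : Type*} (s : Shared) (G : Ghost P) : Prop where
  none_notMem : none ∉ s.usedNodes
  ready_used : ∀ n ∈ G.ready, n ∈ s.usedNodes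
  node_ready : ∀ i < G.len, G.nodeAt i ∈ G.ready
  nodeAt_none : ∀ i, G.len ≤ i → G.nodeAt i = none
  inj : ∀ i < G.len, ∀ j < G.len, G.nodeAt i = G.nodeAt j → i = j
  next : ∀ i < G.len, (s.node (G.nodeAt i)).next = G.nodeAt (i + 1)
  fresh : ∀ n ∈ G.ready, (∀ i < G.len, G.nodeAt i ≠ n) →
    (s.node n).next = none ∧ (s.node n).flag = false
  flag : ∀ i ≤ G.tailPos, (s.node (G.nodeAt i)).flag = true
  tail : G.nodeAt G.tailPos = s.tail
  tail_lt : G.tailPos < G.len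
  len_le : G.len ≤ G.tailPos + 2
  head : G.nodeAt G.headPos = s.head.ptr
  head_le : G.headPos ≤ G.tailPos
  annE : s.annE ∈ G.ready
  annD : s.annD ∈ G.readyLoc
  readyLoc_used : ∀ a ∈ G.readyLoc, a ∈ s.usedLocs
  val_ready : ∀ a x, G.val a = some x → a ∈ G.readyLoc
  val_head : G.val s.head.addr = some s.head.value
  val_ne : ∀ a, G.val a ≠ some .null
  cell_val : ∀ a x, G.val a = some x → a ≠ s.head.addr → s.cell a = x
  val_cell : ∀ a ∈ G.readyLoc, s.cell a ≠ .null →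
    ∃ x, G.val a = some x ∧ (a = G.initLoc ∨ s.cell a = x)
  value : ∀ n ∈ G.ready, ∀ q v, G.owner n = some (q, v) → (s.node n).value = v
  initLoc_used : G.initLoc ∈ s.usedLocs

/-- How the shared memory may change in a step of process `p`, as far as the other processes and
the abstract queue are concerned. -/
structure Evolves {P : Type*} (p : P) (s : Shared) (G : Ghost P) (s' : Shared) (G' : Ghost P) :
    Prop where
  nodeAt : ∀ i < G.len, G'.nodeAt i = G.nodeAt i
  len_le : G.len ≤ G'.len
  tail_le : G.tailPos ≤ G'.tailPos
  tail_le_succ : G'.tailPos ≤ G.tailPos + 1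
  ready : ∀ n ∈ G.ready, n ∈ G'.ready
  readyLoc : ∀ a ∈ G.readyLoc, a ∈ G'.readyLoc
  used : ∀ n ∈ s.usedNodes, n ∈ s'.usedNodes
  usedLocs : ∀ a ∈ s.usedLocs, a ∈ s'.usedLocs
  owner : ∀ n ∈ s.usedNodes, G'.owner n = G.owner n
  ownerLoc : ∀ a ∈ s.usedLocs, G'.ownerLoc a = G.ownerLoc a
  flag : ∀ n ∈ G.ready, (s.node n).flag = true → (s'.node n).flag = true
  value : ∀ n ∈ G.ready, (s'.node n).value = (s.node n).value
  initLoc : G'.initLoc = G.initLoc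
  priv : ∀ n q v, q ≠ p → G.owner n = some (q, v) → n ∈ s.usedNodes → n ∉ G.ready →
    n ∉ G'.ready ∧ s'.node n = s.node n
  privLoc : ∀ a q, q ≠ p → G.ownerLoc a = some q → a ∈ s.usedLocs → a ∉ G.readyLoc →
    a ∉ G'.readyLoc
  cell_ne : ∀ a ∈ G.readyLoc, s.cell a ≠ .null → s'.cell a ≠ .null
  cell_val : ∀ a x, G.val a = some x → s.cell a = x → s'.cell a = x
  head : (s'.head = s.head ∧ G'.val = G.val ∧ G'.headPos = G.headPos) ∨
    (G.val s'.head.addr = none ∧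
      G'.val = Function.update G.val s'.head.addr (some s'.head.value) ∧
      G'.tailPos = G.tailPos ∧
      ((s'.head.value = .bot ∧ G'.headPos = G.headPos) ∨
        (G'.headPos = G.headPos + 1 ∧ G.headPos + 1 ≤ G.tailPos ∧
          s'.head.value = .elem (s.node (G.nodeAt (G.headPos + 1))).value)))

theorem Evolves.refl {P : Type*} (p : P) (s : Shared) (G : Ghost P) : Evolves p s G s G := by
  constructor <;> grind

/-! ### The assertions of a process -/

section assertions
variable {P : Type*}

/-- The argument of `trytoenqueue` is ready, and is the own node of a process that performs its own
operation. -/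
def EnqArg (G : Ghost P) (l : Locals) : Prop :=
  l.argNode ∈ G.ready ∧ (l.selfish = true → l.argNode = l.lnode)

/-- The argument of `trytodequeue` is ready, and is the own location of a process that performs its
own operation. -/
def DeqArg (G : Ghost P) (l : Locals) : Prop :=
  l.argAddr ∈ G.readyLoc ∧ (l.selfish = true → l.argAddr = l.addr ∧ l.addr ≠ G.initLoc)

/-- The local copy of `g_Head`, with `ptr` at position `i`, is a former value of `g_Head`. -/
def HeadRead (s : Shared) (G : Ghost P) (l : Locals) (i : ℕ) : Prop :=
  G.val l.head.addr = some l.head.value ∧ i ≤ G.headPos ∧ G.nodeAt i = l.head.ptr ∧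
    (s.head.addr = l.head.addr → s.head = l.head)

/-- Node `n` has been pointed to by `g_Tail`. -/
def Reached (G : Ghost P) (n : NodePtr) : Prop := ∃ j ≤ G.tailPos, G.nodeAt j = n

/-- The local copy of `g_Tail` is at position `i`, and was `g_Tail` at some time. -/
def TailRead (G : Ghost P) (l : Locals) (i : ℕ) : Prop := i ≤ G.tailPos ∧ G.nodeAt i = l.tail

/-- `n` is the node at position `i`. -/
def LinkedAt (G : Ghost P) (i : ℕ) (n : NodePtr) : Prop := i < G.len ∧ G.nodeAt i = n

/-- The attempt to set `g_Head.addr` can only succeed if it has never been `argAddr`. -/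
def Unserved (s : Shared) (G : Ghost P) (l : Locals) : Prop :=
  s.head.addr = l.head.addr → G.val l.argAddr = none

/-- What holds whenever process `p` is about to execute line `l.pc`. -/
def ProcInv (p : P) (s : Shared) (G : Ghost P) (l : Locals) : Prop :=
  match l.pc with
  | .idle | .e1 | .e3 | .d1 | .d4 => True
  | .e2 => l.annE ∈ G.ready
  | .e4 => l.lnode ∈ s.usedNodes ∧ l.lnode ∉ G.ready ∧ G.owner l.lnode = some (p, l.v)
  | .e5 => l.lnode ∈ s.usedNodes ∧ l.lnode ∉ G.ready ∧ G.owner l.lnode = some (p, l.v) ∧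
      (s.node l.lnode).value = l.v
  | .e6 => l.lnode ∈ s.usedNodes ∧ l.lnode ∉ G.ready ∧ G.owner l.lnode = some (p, l.v) ∧
      (s.node l.lnode).value = l.v ∧ (s.node l.lnode).next = none
  | .e7 | .e8 => l.lnode ∈ G.ready
  | .e9 => Reached G l.lnode
  | .d2 | .d3 => l.annD ∈ G.readyLoc
  | .d5 => l.addr ∈ s.usedLocs ∧ l.addr ∉ G.readyLoc ∧ G.ownerLoc l.addr = some p ∧
      l.addr ≠ G.initLoc
  | .d6 | .d7 => l.addr ∈ G.readyLoc ∧ l.addr ≠ G.initLoc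
  | .d8 => G.val l.addr = some l.t
  | .te1 | .te17 => EnqArg G l
  | .te2 => EnqArg G l ∧ ∃ i, TailRead G l i
  | .te3 => EnqArg G l ∧ ∃ i, TailRead G l i ∧ (l.next = none ∨ LinkedAt G (i + 1) l.next)
  | .te4 => EnqArg G l ∧ ∃ j, LinkedAt G j l.argNode
  | .te5 => EnqArg G l ∧ ∃ i, TailRead G l i ∧ ∃ j ≤ i + 1, LinkedAt G j l.argNode
  | .te6 => EnqArg G l ∧ ∃ i, TailRead G l i ∧ ∃ j ≤ i + 1, LinkedAt G j l.argNode ∧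
      ((l.next = none ∧ j ≤ i) ∨ LinkedAt G (i + 1) l.next)
  | .te7 => EnqArg G l ∧ ∃ i, TailRead G l i ∧ (∃ j ≤ i + 1, LinkedAt G j l.argNode) ∧
      LinkedAt G (i + 1) l.next
  | .te8 => EnqArg G l ∧ ∃ i, TailRead G l i ∧ (∃ j ≤ i + 1, LinkedAt G j l.argNode) ∧
      LinkedAt G (i + 1) l.next ∧ (s.node l.next).flag = true
  | .te9 | .te16 => EnqArg G l ∧ Reached G l.argNode
  | .te10 => EnqArg G l ∧ ∃ i, TailRead G l i ∧ (l.next = none ∨ LinkedAt G (i + 1) l.next) ∧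
      ∀ j ≤ i, G.nodeAt j ≠ l.argNode
  | .te11 => EnqArg G l ∧ ∃ i, TailRead G l i ∧ LinkedAt G (i + 1) l.next
  | .te12 => EnqArg G l ∧ ∃ i, TailRead G l i ∧ LinkedAt G (i + 1) l.next ∧
      (s.node l.next).flag = true
  | .te13 => EnqArg G l ∧ ∃ i, TailRead G l i ∧ ∀ j ≤ i, G.nodeAt j ≠ l.argNode
  | .te14 => EnqArg G l ∧ ∃ i, TailRead G l i ∧ LinkedAt G (i + 1) l.argNode
  | .te15 => EnqArg G l ∧ ∃ i, TailRead G l i ∧ LinkedAt G (i + 1) l.argNode ∧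
      (s.node l.argNode).flag = true
  | .td1 | .td13 => DeqArg G l
  | .td2 => DeqArg G l ∧ ∃ i, HeadRead s G l i
  | .td3 => DeqArg G l ∧ ∃ i, HeadRead s G l i ∧ ∃ k, i ≤ k ∧ TailRead G l k
  | .td4 => DeqArg G l ∧ ∃ i, HeadRead s G l i ∧ (∃ k, i ≤ k ∧ TailRead G l k) ∧
      s.cell l.head.addr = l.head.value
  | .td5 => DeqArg G l ∧ s.cell l.argAddr ≠ .null
  | .td6 => DeqArg G l ∧ ∃ i, HeadRead s G l i ∧ (∃ k, i ≤ k ∧ TailRead G l k) ∧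
      s.cell l.head.addr = l.head.value ∧ Unserved s G l
  | .td7 => DeqArg G l ∧ ∃ i, HeadRead s G l i ∧ s.cell l.head.addr = l.head.value ∧
      Unserved s G l
  | .td8 => DeqArg G l ∧ G.val l.argAddr = some .bot
  | .td9 => DeqArg G l ∧ ∃ i, HeadRead s G l i ∧ s.cell l.head.addr = l.head.value ∧
      Unserved s G l ∧ i + 1 ≤ G.tailPos
  | .td10 => DeqArg G l ∧ ∃ i, HeadRead s G l i ∧ s.cell l.head.addr = l.head.value ∧
      Unserved s G l ∧ i + 1 ≤ G.tailPos ∧ G.nodeAt (i + 1) = l.next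
  | .td11 => DeqArg G l ∧ ∃ i, HeadRead s G l i ∧ s.cell l.head.addr = l.head.value ∧
      Unserved s G l ∧ i + 1 ≤ G.tailPos ∧ G.nodeAt (i + 1) = l.next ∧
      (s.node l.next).value = l.w
  | .td12 => DeqArg G l ∧ G.val l.argAddr = some (.elem l.w)

section stability
variable {p q : P} {s s' : Shared} {G G' : Ghost P} {l : Locals} {i : ℕ} {n : NodePtr}

theorem EnqArg.stable (h : EnqArg G l) (e : Evolves p s G s' G') : EnqArg G' l :=
  ⟨e.ready _ h.1, h.2⟩

theorem DeqArg.stable (h : DeqArg G l) (e : Evolves p s G s' G') : DeqArg G' l :=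
  ⟨e.readyLoc _ h.1, by rw [e.initLoc]; exact h.2⟩

theorem Evolves.val {a : LocPtr} {x : Cell} (e : Evolves p s G s' G') (h : G.val a = some x) :
    G'.val a = some x := by
  rcases e.head with e | e
  · rw [e.2.1, h]
  · rw [e.2.1, Function.update_of_ne (by grind), h]

theorem Evolves.headPos_le (e : Evolves p s G s' G') : G.headPos ≤ G'.headPos := by
  rcases e.head with e | e <;> grind

theorem HeadRead.stable (I : SharedInv s G) (h : HeadRead s G l i) (e : Evolves p s G s' G') :
    HeadRead s' G' l i := by
  obtain ⟨h1, h2, h3, h4⟩ := h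
  have := I.head_le
  have := I.tail_lt
  refine ⟨e.val h1, h2.trans e.headPos_le, by rw [e.nodeAt _ (by lia), h3], ?_⟩
  rcases e.head with e | e <;> grind

theorem Reached.stable (I : SharedInv s G) (h : Reached G n) (e : Evolves p s G s' G') :
    Reached G' n := by
  obtain ⟨j, hj, rfl⟩ := h
  exact ⟨j, hj.trans e.tail_le, e.nodeAt _ (hj.trans_lt I.tail_lt)⟩

theorem TailRead.stable (I : SharedInv s G) (h : TailRead G l i) (e : Evolves p s G s' G') :
    TailRead G' l i :=
  ⟨h.1.trans e.tail_le, (e.nodeAt _ (h.1.trans_lt I.tail_lt)).trans h.2⟩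

theorem LinkedAt.stable (h : LinkedAt G i n) (e : Evolves p s G s' G') : LinkedAt G' i n :=
  ⟨h.1.trans_le e.len_le, (e.nodeAt _ h.1).trans h.2⟩

theorem Unserved.stable (hr : HeadRead s G l i) (h : Unserved s G l) (e : Evolves p s G s' G') :
    Unserved s' G' l := by
  unfold Unserved HeadRead at *
  rcases e.head with e | e <;> grind

theorem LinkedAt.ready (I : SharedInv s G) (h : LinkedAt G i n) : n ∈ G.ready := by
  rw [← h.2]; exact I.node_ready _ h.1

theorem TailRead.ne_stable (I : SharedInv s G) (h : TailRead G l i) (e : Evolves p s G s' G')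
    (h' : ∀ j ≤ i, G.nodeAt j ≠ n) : ∀ j ≤ i, G'.nodeAt j ≠ n := by
  intro j hj
  rw [e.nodeAt _ ((hj.trans h.1).trans_lt I.tail_lt)]
  exact h' j hj

/-- The assertions of a process are not invalidated by the steps of other processes. -/
theorem ProcInv.stable (I : SharedInv s G) (h : ProcInv q s G l) (hq : q ≠ p)
    (e : Evolves p s G s' G') : ProcInv q s' G' l := by
  unfold ProcInv at h ⊢
  cases hpc : l.pc <;> simp only [hpc] at h ⊢
  case e2 => exact e.ready _ h
  case e4 =>
    obtain ⟨h1, h2, h3⟩ := h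
    exact ⟨e.used _ h1, (e.priv _ q _ hq h3 h1 h2).1, (e.owner _ h1).trans h3⟩
  case e5 | e6 =>
    obtain ⟨h1, h2, h3, h4⟩ := h
    obtain ⟨h5, h6⟩ := e.priv _ q _ hq h3 h1 h2
    rw [h6]
    exact ⟨e.used _ h1, h5, (e.owner _ h1).trans h3, h4⟩
  case e7 | e8 => exact e.ready _ h
  case e9 => exact h.stable I e
  case d2 | d3 => exact e.readyLoc _ h
  case d5 =>
    obtain ⟨h1, h2, h3, h4⟩ := h
    exact ⟨e.usedLocs _ h1, e.privLoc _ q hq h3 h1 h2, (e.ownerLoc _ h1).trans h3,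
      e.initLoc ▸ h4⟩
  case d6 | d7 => exact ⟨e.readyLoc _ h.1, e.initLoc ▸ h.2⟩
  case d8 => exact e.val h
  case te1 | te17 => exact h.stable e
  case te2 =>
    obtain ⟨h, i, h1⟩ := h
    exact ⟨h.stable e, i, h1.stable I e⟩
  case te3 =>
    obtain ⟨h, i, h1, h2⟩ := h
    exact ⟨h.stable e, i, h1.stable I e, h2.imp_right (·.stable e)⟩
  case te4 =>
    obtain ⟨h, i, h1⟩ := h
    exact ⟨h.stable e, i, h1.stable e⟩
  case te5 =>
    obtain ⟨h, i, h1, j, h2, h3⟩ := h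
    exact ⟨h.stable e, i, h1.stable I e, j, h2, h3.stable e⟩
  case te6 =>
    obtain ⟨h, i, h1, j, h2, h3, h4⟩ := h
    exact ⟨h.stable e, i, h1.stable I e, j, h2, h3.stable e, h4.imp_right (·.stable e)⟩
  case te7 =>
    obtain ⟨h, i, h1, ⟨j, h2, h3⟩, h4⟩ := h
    exact ⟨h.stable e, i, h1.stable I e, ⟨j, h2, h3.stable e⟩, h4.stable e⟩
  case te8 =>
    obtain ⟨h, i, h1, ⟨j, h2, h3⟩, h4, h5⟩ := h
    exact ⟨h.stable e, i, h1.stable I e, ⟨j, h2, h3.stable e⟩, h4.stable e,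
      e.flag _ (h4.ready I) h5⟩
  case te9 | te16 => exact ⟨h.1.stable e, h.2.stable I e⟩
  case te10 =>
    obtain ⟨h, i, h1, h2, h3⟩ := h
    exact ⟨h.stable e, i, h1.stable I e, h2.imp_right (·.stable e), h1.ne_stable I e h3⟩
  case te11 | te14 =>
    obtain ⟨h, i, h1, h2⟩ := h
    exact ⟨h.stable e, i, h1.stable I e, h2.stable e⟩
  case te12 | te15 =>
    obtain ⟨h, i, h1, h2, h3⟩ := h
    exact ⟨h.stable e, i, h1.stable I e, h2.stable e, e.flag _ (h2.ready I) h3⟩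
  case te13 =>
    obtain ⟨h, i, h1, h3⟩ := h
    exact ⟨h.stable e, i, h1.stable I e, h1.ne_stable I e h3⟩
  case td1 | td13 => exact h.stable e
  case td2 =>
    obtain ⟨h, i, h1⟩ := h
    exact ⟨h.stable e, i, h1.stable I e⟩
  case td3 =>
    obtain ⟨h, i, h1, k, h2, h3⟩ := h
    exact ⟨h.stable e, i, h1.stable I e, k, h2, h3.stable I e⟩
  case td4 =>
    obtain ⟨h, i, h1, ⟨k, h2, h3⟩, h4⟩ := h
    exact ⟨h.stable e, i, h1.stable I e, ⟨k, h2, h3.stable I e⟩, e.cell_val _ _ h1.1 h4⟩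
  case td5 => exact ⟨h.1.stable e, e.cell_ne _ h.1.1 h.2⟩
  case td6 =>
    obtain ⟨h, i, h1, ⟨k, h2, h3⟩, h4, h5⟩ := h
    exact ⟨h.stable e, i, h1.stable I e, ⟨k, h2, h3.stable I e⟩, e.cell_val _ _ h1.1 h4,
      h5.stable h1 e⟩
  case td7 =>
    obtain ⟨h, i, h1, h4, h5⟩ := h
    exact ⟨h.stable e, i, h1.stable I e, e.cell_val _ _ h1.1 h4, h5.stable h1 e⟩
  case td8 | td12 => exact ⟨h.1.stable e, e.val h.2⟩
  case td9 =>
    obtain ⟨h, i, h1, h4, h5, h6⟩ := h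
    exact ⟨h.stable e, i, h1.stable I e, e.cell_val _ _ h1.1 h4, h5.stable h1 e,
      h6.trans e.tail_le⟩
  case td10 =>
    obtain ⟨h, i, h1, h4, h5, h6, h7⟩ := h
    exact ⟨h.stable e, i, h1.stable I e, e.cell_val _ _ h1.1 h4, h5.stable h1 e,
      h6.trans e.tail_le, (e.nodeAt _ (h6.trans_lt I.tail_lt)).trans h7⟩
  case td11 =>
    obtain ⟨h, i, h1, h4, h5, h6, h7, h8⟩ := h
    have h9 := h6.trans_lt I.tail_lt
    exact ⟨h.stable e, i, h1.stable I e, e.cell_val _ _ h1.1 h4, h5.stable h1 e,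
      h6.trans e.tail_le, (e.nodeAt _ h9).trans h7,
      (e.value _ (h7 ▸ I.node_ready _ h9)).trans h8⟩
end stability
end assertions

/-! ### Steps that change the shared memory -/

section updates
variable {P : Type*} {p : P} {s : Shared} {G : Ghost P}

theorem SharedInv.allocNode (I : SharedInv s G) {n : NodePtr} (hn : n ≠ none)
    (h : n ∉ s.usedNodes) (v : ℤ) :
    let s' : Shared := { s with usedNodes := insert n s.usedNodes }
    let G' : Ghost P := { G with owner := Function.update G.owner n (some (p, v)) }
    SharedInv s' G' ∧ Evolves p s G s' G' := by
  have h1 : ∀ m ∈ s.usedNodes, Function.update G.owner n (some (p, v)) m = G.owner m :=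
    fun m hm => Function.update_of_ne (by rintro rfl; exact h hm) _ _
  refine ⟨{ I with none_notMem := ?_, ready_used := ?_, value := ?_ },
    { Evolves.refl p s G with used := ?_, owner := h1 }⟩
  · have := I.none_notMem
    simp_all [Ne.symm hn]
  · exact fun m hm => Set.mem_insert_of_mem _ (I.ready_used m hm)
  · intro m hm q v' h2
    exact I.value m hm q v' (by rw [← h2]; exact (h1 m (I.ready_used m hm)).symm)
  · exact fun m hm => Set.mem_insert_of_mem _ hm

/-- A node that is not ready is only accessed by its owner, so its contents do not matter. -/
theorem SharedInv.updatePrivate (I : SharedInv s G) {n : NodePtr} {v : ℤ} (h : n ∉ G.ready)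
    (ho : G.owner n = some (p, v)) (x : Node) :
    let s' : Shared := { s with node := Function.update s.node n x }
    SharedInv s' G ∧ Evolves p s G s' G := by
  have h1 : ∀ m ∈ G.ready, Function.update s.node n x m = s.node m :=
    fun m hm => Function.update_of_ne (by rintro rfl; exact h hm) _ _
  refine ⟨{ I with next := ?_, fresh := ?_, flag := ?_, value := ?_ },
    { Evolves.refl p s G with flag := ?_, value := ?_, priv := ?_ }⟩
  · intro i hi
    simpa only [h1 _ (I.node_ready i hi)] using I.next i hi
  · intro m hm
    simpa only [h1 _ hm] using I.fresh m hm
  · intro i hi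
    simpa only [h1 _ (I.node_ready i (hi.trans_lt I.tail_lt))] using I.flag i hi
  · intro m hm
    simpa only [h1 _ hm] using I.value m hm
  · intro m hm hf
    simpa only [h1 _ hm] using hf
  · intro m hm
    simp only [h1 _ hm]
  · intro m q v' hq h2 h3 h4
    refine ⟨h4, Function.update_of_ne ?_ _ _⟩
    rintro rfl
    grind

theorem SharedInv.publish (I : SharedInv s G) {n : NodePtr} {v : ℤ} (h : n ∉ G.ready)
    (hu : n ∈ s.usedNodes) (ho : G.owner n = some (p, v)) (hv : (s.node n).value = v)
    (hx : (s.node n).next = none) (hf : (s.node n).flag = false) :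
    let G' : Ghost P := { G with ready := insert n G.ready }
    SharedInv s G' ∧ Evolves p s G s G' := by
  refine ⟨{ I with ready_used := ?_, node_ready := ?_, fresh := ?_, value := ?_, annE := ?_ },
    { Evolves.refl p s G with ready := ?_, priv := ?_ }⟩
  · rintro m (rfl | hm)
    exacts [hu, I.ready_used m hm]
  · exact fun i hi => Set.mem_insert_of_mem _ (I.node_ready i hi)
  · rintro m (rfl | hm)
    exacts [fun _ => ⟨hx, hf⟩, I.fresh m hm]
  · exact Set.mem_insert_of_mem _ I.annE
  · rintro m (rfl | hm)
    · intro q v' h2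
      grind
    · exact I.value m hm
  · exact fun i hi => Set.mem_insert_of_mem _ hi
  · intro m q v' hq h2 h3 h4
    refine ⟨?_, rfl⟩
    rintro (rfl | h5)
    · grind
    · exact h4 h5

/-- A change of node contents that leaves the ghost state alone, followed by another change. -/
theorem Evolves.trans_ready {s₁ s₂ : Shared} {G₂ : Ghost P} (e : Evolves p s G s₁ G)
    (e' : Evolves p s₁ G s₂ G₂) (hh : s₁.head = s.head)
    (hv : ∀ n, (s₁.node n).value = (s.node n).value) :
    Evolves p s G s₂ G₂ where
  nodeAt := e'.nodeAt
  len_le := e'.len_le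
  tail_le := e'.tail_le
  tail_le_succ := e'.tail_le_succ
  ready := e'.ready
  readyLoc := e'.readyLoc
  used n h := e'.used n (e.used n h)
  usedLocs n h := e'.usedLocs n (e.usedLocs n h)
  owner n h := e'.owner n (e.used n h)
  ownerLoc n h := e'.ownerLoc n (e.usedLocs n h)
  flag n h h' := e'.flag n h (e.flag n h h')
  value n h := (e'.value n h).trans (e.value n h)
  initLoc := e'.initLoc
  priv n q v h1 h2 h3 h4 := by
    have h5 := e'.priv n q v h1 h2 (e.used n h3) h4
    exact ⟨h5.1, h5.2.trans (e.priv n q v h1 h2 h3 h4).2⟩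
  privLoc a q h1 h2 h3 h4 := e'.privLoc a q h1 h2 (e.usedLocs a h3) h4
  cell_ne a h h' := e'.cell_ne a h (e.cell_ne a h h')
  cell_val a x h h' := e'.cell_val a x h (e.cell_val a x h h')
  head := by simpa only [hh, hv] using e'.head

theorem SharedInv.setAnnE (I : SharedInv s G) {n : NodePtr} (h : n ∈ G.ready) :
    SharedInv { s with annE := n } G ∧ Evolves p s G { s with annE := n } G :=
  ⟨{ I with annE := h }, { Evolves.refl p s G with }⟩

theorem SharedInv.setAnnD (I : SharedInv s G) {a : LocPtr} (h : a ∈ G.readyLoc) :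
    SharedInv { s with annD := a } G ∧ Evolves p s G { s with annD := a } G :=
  ⟨{ I with annD := h }, { Evolves.refl p s G with }⟩

theorem SharedInv.allocLoc (I : SharedInv s G) {a : LocPtr} (h : a ∉ s.usedLocs) :
    let s' : Shared := { s with usedLocs := insert a s.usedLocs }
    let G' : Ghost P := { G with ownerLoc := Function.update G.ownerLoc a (some p) }
    SharedInv s' G' ∧ Evolves p s G s' G' := by
  have h1 : ∀ m ∈ s.usedLocs, Function.update G.ownerLoc a (some p) m = G.ownerLoc m :=
    fun m hm => Function.update_of_ne (by rintro rfl; exact h hm) _ _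
  exact ⟨{ I with
      readyLoc_used := fun m hm => Set.mem_insert_of_mem _ (I.readyLoc_used m hm)
      initLoc_used := Set.mem_insert_of_mem _ I.initLoc_used },
    { Evolves.refl p s G with usedLocs := fun m hm => Set.mem_insert_of_mem _ hm, ownerLoc := h1 }⟩

theorem SharedInv.publishLoc (I : SharedInv s G) {a : LocPtr} (h : a ∉ G.readyLoc)
    (hu : a ∈ s.usedLocs) (ho : G.ownerLoc a = some p) :
    let G' : Ghost P := { G with readyLoc := insert a G.readyLoc }
    SharedInv (s.setCell a .null) G' ∧ Evolves p s G (s.setCell a .null) G' := by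
  have h1 : ∀ m ∈ G.readyLoc, (s.setCell a .null).cell m = s.cell m :=
    fun m hm => Function.update_of_ne (by rintro rfl; exact h hm) _ _
  refine ⟨{ I with annD := ?_, readyLoc_used := ?_, val_ready := ?_, cell_val := ?_,
                   val_cell := ?_ },
    { Evolves.refl p s G with readyLoc := ?_, privLoc := ?_, cell_ne := ?_, cell_val := ?_ }⟩
  · exact Set.mem_insert_of_mem _ I.annD
  · rintro m (rfl | hm)
    exacts [hu, I.readyLoc_used m hm]
  · exact fun b x hb => Set.mem_insert_of_mem _ (I.val_ready b x hb)
  · intro b x hb hb'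
    rw [h1 b (I.val_ready b x hb)]
    exact I.cell_val b x hb hb'
  · rintro m (rfl | hm) hb
    · simp [Shared.setCell] at hb
    · rw [h1 m hm] at hb ⊢
      exact I.val_cell m hm hb
  · exact fun b hb => Set.mem_insert_of_mem _ hb
  · intro b q hq h2 h3 h4
    rintro (rfl | h5)
    · grind
    · exact h4 h5
  · intro b hb hb'
    rwa [h1 b hb]
  · intro b x hb hb'
    rwa [h1 b (I.val_ready b x hb)]

theorem SharedInv.setFlag (I : SharedInv s G) {i : ℕ} {n : NodePtr} (h : LinkedAt G i n) :
    SharedInv (s.setFlag n true) G ∧ Evolves p s G (s.setFlag n true) G := by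
  have hr := h.ready I
  obtain ⟨hi, rfl⟩ := h
  set n := G.nodeAt i
  have h1 : ∀ m, ((s.setFlag n true).node m).next = (s.node m).next := by
    intro m; by_cases hm : m = n <;> simp [Shared.setFlag, hm]
  have h2 : ∀ m, ((s.setFlag n true).node m).value = (s.node m).value := by
    intro m; by_cases hm : m = n <;> simp [Shared.setFlag, hm]
  have h3 : ∀ m, (s.node m).flag = true → ((s.setFlag n true).node m).flag = true := by
    intro m; by_cases hm : m = n <;> simp [Shared.setFlag, hm]
  have h4 : ∀ m, m ≠ n → (s.setFlag n true).node m = s.node m :=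
    fun m hm => Function.update_of_ne hm _ _
  refine ⟨{ I with next := ?_, fresh := ?_, flag := ?_, value := ?_ },
    { Evolves.refl p s G with flag := fun m _ => h3 m, value := fun m _ => h2 m, priv := ?_ }⟩
  · intro j hj
    rw [h1]; exact I.next j hj
  · intro m hm hm'
    rw [h4 m (hm' i hi).symm]
    exact I.fresh m hm hm'
  · exact fun j hj => h3 _ (I.flag j hj)
  · intro m
    rw [h2]; exact I.value m
  · intro m q v hq _ _ hm
    exact ⟨hm, h4 m (by rintro rfl; exact hm hr)⟩

/-- A CAS on `g_Tail` from position `i` to position `i + 1` leaves `g_Tail` at position `i + 1` or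
later, whether it succeeds or not. -/
theorem SharedInv.casTail (I : SharedInv s G) {i : ℕ} {l : Locals} {n : NodePtr}
    (h : TailRead G l i) (hn : LinkedAt G (i + 1) n) (hf : (s.node n).flag = true) :
    ∃ G', SharedInv (s.casTail l.tail n) G' ∧ Evolves p s G (s.casTail l.tail n) G' ∧
      i + 1 ≤ G'.tailPos := by
  obtain ⟨h1, h2⟩ := h
  obtain ⟨h3, rfl⟩ := hn
  unfold Shared.casTail
  split_ifs with hs
  · have hi : i = G.tailPos := I.inj _ (by lia) _ I.tail_lt (by rw [h2, I.tail, hs])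
    subst hi
    refine ⟨{ G with tailPos := G.tailPos + 1 },
      { I with flag := ?_, tail := rfl, tail_lt := h3, len_le := ?_, head_le := ?_ },
      { Evolves.refl p s G with tail_le := ?_, tail_le_succ := ?_, head := ?_ }, le_rfl⟩
    · intro j hj
      rcases Nat.le_succ_iff.1 hj with hj | rfl
      exacts [I.flag j hj, hf]
    · have := I.len_le
      simp only; lia
    · exact I.head_le.trans (Nat.le_succ _)
    · exact Nat.le_succ _
    · exact le_rfl
    · exact Or.inl ⟨rfl, rfl, rfl⟩
  · refine ⟨G, I, Evolves.refl p s G, ?_⟩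
    rcases h1.lt_or_eq with h1 | rfl
    · exact h1
    · exact absurd (I.tail.symm.trans h2) hs

/-- A node that is appended to the list is not yet in the list: `g_Tail` has already passed the
position where the append takes place. -/
theorem SharedInv.casNext (I : SharedInv s G) {i : ℕ} {l : Locals} (h : TailRead G l i)
    (hr : l.argNode ∈ G.ready) (hn : ∀ j ≤ i, G.nodeAt j ≠ l.argNode) :
    ∃ G', SharedInv (s.casNext l.tail l.argNode) G' ∧
      Evolves p s G (s.casNext l.tail l.argNode) G' ∧
      ((s.node l.tail).next = none → LinkedAt G' (i + 1) l.argNode) := by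
  obtain ⟨h1, h2⟩ := h
  have h0 := I.tail_lt
  unfold Shared.casNext
  split_ifs with hs
  · have h3 : G.len = i + 1 := by
      by_contra h3
      have h4 := I.next i (by lia)
      rw [h2, hs] at h4
      have h5 := I.node_ready (i + 1) (by lia)
      rw [← h4] at h5
      exact I.none_notMem (I.ready_used _ h5)
    have h4 : i = G.tailPos := by lia
    have hn' : ∀ j < G.len, G.nodeAt j ≠ l.argNode := fun j hj => hn j (by lia)
    have h5 : ∀ j < G.len, Function.update G.nodeAt G.len l.argNode j = G.nodeAt j :=
      fun j hj => Function.update_of_ne (by lia) _ _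
    have h6 : Function.update G.nodeAt G.len l.argNode G.len = l.argNode :=
      Function.update_self _ _ _
    set s' := s.setNext l.tail l.argNode with hs'
    have g1 : ∀ m, (s'.node m).flag = (s.node m).flag := by
      intro m; by_cases hm : m = l.tail <;> simp [s', Shared.setNext, hm]
    have g2 : ∀ m, (s'.node m).value = (s.node m).value := by
      intro m; by_cases hm : m = l.tail <;> simp [s', Shared.setNext, hm]
    have g3 : ∀ m, m ≠ l.tail → s'.node m = s.node m :=
      fun m hm => Function.update_of_ne hm _ _
    have g4 : (s'.node l.tail).next = l.argNode := by simp [s', Shared.setNext]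
    have g5 : l.tail ∈ G.ready := h2 ▸ I.node_ready i (by lia)
    have g6 : (s.node l.argNode).next = none := (I.fresh _ hr hn').1
    have g7 : l.argNode ≠ l.tail := by
      rw [← h2]; exact (hn i le_rfl).symm
    refine ⟨{ G with len := G.len + 1, nodeAt := Function.update G.nodeAt G.len l.argNode },
      { I with node_ready := ?_, nodeAt_none := ?_, inj := ?_, next := ?_, fresh := ?_, flag := ?_,
               tail := ?_, tail_lt := ?_, len_le := ?_, head := ?_, value := ?_ },
      { Evolves.refl p s G with nodeAt := h5, len_le := ?_, flag := ?_, value := fun m _ => g2 m,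
                                priv := ?_ }, ?_⟩
    · intro j hj
      rcases Nat.lt_succ_iff_lt_or_eq.1 hj with hj | rfl
      · simp only [h5 j hj]; exact I.node_ready j hj
      · simpa only [h6] using hr
    · intro j hj
      simp only at hj ⊢
      rw [Function.update_of_ne (by lia)]
      exact I.nodeAt_none j (by lia)
    · intro j hj k hk hjk
      simp only at hj hk hjk
      have := I.inj
      grind
    · intro j hj
      rcases Nat.lt_succ_iff_lt_or_eq.1 hj with hj | rfl
      · simp only [h5 j hj]
        by_cases hji : j = i
        · subst hji
          rw [h2, g4, ← h3, h6]
        · rw [h5 (j + 1) (by lia), ← I.next j hj, g3]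
          intro h7
          exact hji (I.inj j hj i (by lia) (h7.trans h2.symm))
      · simp only [h6]
        rw [Function.update_of_ne (by lia), g3 _ g7, g6, I.nodeAt_none _ (by lia)]
    · intro m hm hm'
      simp only at hm hm'
      have h7 : ∀ j < G.len, G.nodeAt j ≠ m := fun j hj => h5 j hj ▸ hm' j (by lia)
      rw [g3 m (by rw [← h2]; exact (h7 i (by lia)).symm)]
      exact I.fresh m hm h7
    · intro j hj
      simp only at hj ⊢
      rw [h5 j (by lia), g1]
      exact I.flag j hj
    · simp only; rw [h5 _ h0]; exact I.tail
    · exact h0.trans (Nat.lt_succ_self _)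
    · simp only; lia
    · simp only; rw [h5 _ (I.head_le.trans_lt h0)]; exact I.head
    · intro m
      rw [g2]; exact I.value m
    · exact Nat.le_succ _
    · intro m _ hm
      rwa [g1]
    · intro m q v hq _ _ hm
      exact ⟨hm, g3 m (by rintro rfl; exact hm g5)⟩
    · intro _
      refine ⟨?_, ?_⟩
      · simp only; lia
      · simp only; rw [← h3, h6]
  · exact ⟨G, I, Evolves.refl p s G, fun h => absurd h hs⟩

/-- A late write to a location that has been in `g_Head` writes the value that belongs to it. -/
theorem SharedInv.writeVal (I : SharedInv s G) {a : LocPtr} {x : Cell} (h : G.val a = some x) :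
    SharedInv (s.setCell a x) G ∧ Evolves p s G (s.setCell a x) G := by
  have h0 : (s.setCell a x).cell a = x := Function.update_self _ _ _
  have h1 : ∀ b, b ≠ a → (s.setCell a x).cell b = s.cell b :=
    fun b hb => Function.update_of_ne hb _ _
  have hx : x ≠ .null := by rintro rfl; exact I.val_ne a h
  refine ⟨{ I with cell_val := ?_, val_cell := ?_ },
    { Evolves.refl p s G with cell_ne := ?_, cell_val := ?_ }⟩
  · intro b y hb hb'
    have := I.cell_val b y hb hb'
    grind
  · intro b hb hb'
    have := I.val_cell b hb
    by_cases hba : b = a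
    · subst hba
      exact ⟨x, h, Or.inr h0⟩
    · rw [h1 b hba] at hb' ⊢
      exact this hb'
  · intro b hb hb'
    grind
  · intro b y hb hb'
    grind

/-- A CAS on `g_Head` can only succeed if `g_Head` did not change since it was read: its field
`addr` never returns to a former value. -/
theorem SharedInv.casHead (I : SharedInv s G) {i k : ℕ} {l : Locals} {n : NodePtr} {x : Cell}
    (ha : l.argAddr ∈ G.readyLoc) (h : HeadRead s G l i)
    (hc : s.cell l.head.addr = l.head.value) (hu : Unserved s G l) (hn : G.nodeAt k = n)
    (hkx : (k = i ∧ x = .bot) ∨ (k = i + 1 ∧ i + 1 ≤ G.tailPos ∧ x = .elem (s.node n).value)) :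
    ∃ G', SharedInv (s.casHead l.head ⟨n, x, l.argAddr⟩) G' ∧
      Evolves p s G (s.casHead l.head ⟨n, x, l.argAddr⟩) G' ∧
      (s.head = l.head → G'.val l.argAddr = some x) := by
  obtain ⟨h1, h2, h3, h4⟩ := h
  unfold Shared.casHead
  split_ifs with hs
  · have hv := hu (by rw [hs])
    have h0 := I.tail_lt
    have h5 := I.head_le
    have hi : i = G.headPos := by
      refine I.inj _ (by lia) _ (by lia) ?_
      rw [h3, I.head, hs]
    subst hi
    have hx : x ≠ .null := by rcases hkx with h | h <;> simp [h]
    have h6 : ∀ b y, G.val b = some y → b ≠ l.argAddr := by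
      rintro b y hb rfl
      rw [hv] at hb; exact absurd hb (by simp)
    have h7 : ∀ b, b ≠ l.argAddr →
        Function.update G.val l.argAddr (some x) b = G.val b :=
      fun b hb => Function.update_of_ne hb _ _
    have h8 : Function.update G.val l.argAddr (some x) l.argAddr = some x :=
      Function.update_self _ _ _
    refine ⟨{ G with headPos := k, val := Function.update G.val l.argAddr (some x) },
      { I with head := hn, head_le := ?_, val_ready := ?_, val_head := h8, val_ne := ?_,
               cell_val := ?_, val_cell := ?_ },
      { Evolves.refl p s G with head := ?_ }, fun _ => h8⟩
    · simp only; lia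
    · intro b y hb
      simp only at hb
      by_cases hba : b = l.argAddr
      · rw [hba]; exact ha
      · rw [h7 b hba] at hb; exact I.val_ready b y hb
    · intro b hb
      simp only at hb
      by_cases hba : b = l.argAddr
      · rw [hba, h8] at hb; exact hx (Option.some.inj hb)
      · rw [h7 b hba] at hb; exact I.val_ne b hb
    · intro b y hb hba
      simp only at hb hba
      rw [h7 b hba] at hb
      by_cases hbh : b = s.head.addr
      · subst hbh
        have h9 := I.val_head
        rw [hb] at h9
        rw [Option.some.inj h9, hs]; exact hc
      · exact I.cell_val b y hb hbh
    · intro b hb hb'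
      obtain ⟨y, hy, hy'⟩ := I.val_cell b hb hb'
      exact ⟨y, (h7 b (h6 b y hy)).trans hy, hy'⟩
    · refine Or.inr ⟨hv, rfl, rfl, ?_⟩
      rcases hkx with ⟨rfl, rfl⟩ | ⟨rfl, h, rfl⟩
      · exact Or.inl ⟨rfl, rfl⟩
      · exact Or.inr ⟨rfl, h, by rw [hn]⟩
  · exact ⟨G, I, Evolves.refl p s G, fun h => absurd h hs⟩
end updates

/-! ### Preservation of the invariant -/

section steps
variable {P : Type*} {p : P} {s s' : Shared} {G : Ghost P} {l l' : Locals} {e : Option Event}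

theorem ProcInv.enqDone (h : EnqArg G l) (hr : Reached G l.argNode) :
    ProcInv p s G l.enqDone := by
  unfold Locals.enqDone
  split_ifs with hs
  · exact (h.2 hs) ▸ hr
  · trivial

theorem ProcInv.enqFailed (h : EnqArg G l) : ProcInv p s G l.enqFailed := by
  unfold Locals.enqFailed
  split_ifs with hs
  · exact (h.2 hs) ▸ h.1
  · trivial

theorem ProcInv.deqReturn (h : DeqArg G l) {x : Cell}
    (hx : l.argAddr ≠ G.initLoc → G.val l.argAddr = some x) : ProcInv p s G (l.deqReturn x) := by
  unfold Locals.deqReturn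
  split_ifs with hs
  · obtain ⟨h1, h2⟩ := h.2 hs
    rw [h1] at hx
    exact hx h2
  · trivial

theorem ProcInv.deqFailed (h : DeqArg G l) : ProcInv p s G l.deqFailed := by
  unfold Locals.deqFailed
  split_ifs with hs
  · obtain ⟨h1, h2⟩ := h.2 hs
    exact ⟨h1 ▸ h.1, h2⟩
  · trivial

/-- The node after position `i` is at position `i + 1` if there is one. -/
theorem SharedInv.next_linkedAt (I : SharedInv s G) {i : ℕ} {n : NodePtr} (hi : i ≤ G.tailPos)
    (h : G.nodeAt i = n) :
    (s.node n).next = none ∧ G.len = i + 1 ∨ LinkedAt G (i + 1) (s.node n).next := by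
  have h1 := I.tail_lt
  have h2 := I.next i (by lia)
  rw [h] at h2
  by_cases h3 : i + 1 < G.len
  · exact Or.inr ⟨h3, h2.symm⟩
  · exact Or.inl ⟨by rw [h2, I.nodeAt_none _ (by lia)], by lia⟩

/-- A dequeue that finds its location unwritten after it has written to the location in `g_Head` has
not been served, unless `g_Head` has changed meanwhile. -/
theorem SharedInv.unserved (I : SharedInv s G) {i : ℕ} (h : HeadRead s G l i)
    (hc : s.cell l.head.addr = l.head.value) (h0 : s.cell l.argAddr = .null) :
    Unserved s G l := by
  intro hh
  by_contra hv
  obtain ⟨x, hx⟩ := Option.ne_none_iff_exists'.1 hv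
  have h1 := I.val_ne l.argAddr
  have h2 := I.val_ne l.head.addr
  by_cases ha : l.argAddr = s.head.addr
  · rw [ha, hh, hc] at h0
    rw [h.1, h0] at h2
    exact h2 rfl
  · rw [I.cell_val _ x hx ha] at h0
    rw [hx, h0] at h1
    exact h1 rfl

/-- Every step preserves the invariant, for a suitable change of the ghost state. -/
theorem SharedInv.step (I : SharedInv s G) (hp : ProcInv p s G l) (h : LStep s l e s' l') :
    ∃ G', SharedInv s' G' ∧ Evolves p s G s' G' ∧ ProcInv p s' G' l' := by
  have e0 := Evolves.refl p s G
  have h0 := I.tail_lt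
  unfold ProcInv at hp
  cases h with
  | invEnq v h => exact ⟨G, I, e0, trivial⟩
  | invDeq h => exact ⟨G, I, e0, trivial⟩
  | e1 h => exact ⟨G, I, e0, I.annE⟩
  | e2 h =>
    simp only [h] at hp
    exact ⟨G, I, e0, hp, by simp⟩
  | e3 n h hn hu =>
    obtain ⟨I', e'⟩ := I.allocNode (p := p) hn hu l.v
    exact ⟨_, I', e', Set.mem_insert _ _, fun h => hu (I.ready_used _ h),
      Function.update_self _ _ _⟩
  | e4 h =>
    simp only [h] at hp
    obtain ⟨I', e'⟩ := I.updatePrivate hp.2.1 hp.2.2 { s.node l.lnode with value := l.v }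
    exact ⟨_, I', e', hp.1, hp.2.1, hp.2.2, by simp [Shared.setValue]⟩
  | e5 h =>
    simp only [h] at hp
    obtain ⟨h1, h2, h3, h4⟩ := hp
    obtain ⟨I', e'⟩ := I.updatePrivate h2 h3 { s.node l.lnode with next := none }
    exact ⟨_, I', e', h1, h2, h3, by simp [Shared.setNext, h4], by simp [Shared.setNext]⟩
  | e6 h =>
    simp only [h] at hp
    obtain ⟨h1, h2, h3, h4, h5⟩ := hp
    obtain ⟨I', e'⟩ := I.updatePrivate h2 h3 { s.node l.lnode with flag := false }
    obtain ⟨I'', e''⟩ := I'.publish h2 h1 h3 (by simp [h4]) (by simp [h5]) (by simp)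
    refine ⟨_, I'', e'.trans_ready e'' rfl ?_, Set.mem_insert _ _⟩
    intro m; by_cases hm : m = l.lnode <;> simp [hm]
  | e7 h =>
    simp only [h] at hp
    exact ⟨G, I, e0, hp, fun _ => rfl⟩
  | e8 h =>
    simp only [h] at hp
    obtain ⟨I', e'⟩ := I.setAnnE (p := p) hp
    exact ⟨G, I', e', hp⟩
  | e9 h => exact ⟨G, I, e0, trivial⟩
  | d1 h => exact ⟨G, I, e0, I.annD⟩
  | d2 h =>
    simp only [h] at hp
    refine ⟨G, I, e0, ?_⟩
    split_ifs
    exacts [hp, trivial]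
  | d3 h =>
    simp only [h] at hp
    exact ⟨G, I, e0, hp, by simp⟩
  | d4 a h hu =>
    obtain ⟨I', e'⟩ := I.allocLoc (p := p) hu
    exact ⟨_, I', e', Set.mem_insert _ _, fun h => hu (I.readyLoc_used _ h),
      Function.update_self _ _ _, fun h : a = G.initLoc => hu (h ▸ I.initLoc_used)⟩
  | d5 h =>
    simp only [h] at hp
    obtain ⟨h1, h2, h3, h4⟩ := hp
    obtain ⟨I', e'⟩ := I.publishLoc h2 h1 h3
    exact ⟨_, I', e', Set.mem_insert _ _, h4⟩
  | d6 h =>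
    simp only [h] at hp
    exact ⟨G, I, e0, hp.1, fun _ => ⟨rfl, hp.2⟩⟩
  | d7 h =>
    simp only [h] at hp
    obtain ⟨I', e'⟩ := I.setAnnD (p := p) hp.1
    exact ⟨G, I', e', hp⟩
  | d8 h => exact ⟨G, I, e0, trivial⟩
  | te1 h =>
    simp only [h] at hp
    exact ⟨G, I, e0, hp, G.tailPos, le_rfl, I.tail⟩
  | te2 h =>
    simp only [h] at hp
    obtain ⟨h1, i, h2⟩ := hp
    exact ⟨G, I, e0, h1, i, h2, (I.next_linkedAt h2.1 h2.2).imp_left And.left⟩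
  | te3 h =>
    simp only [h] at hp
    obtain ⟨h1, i, h2, h3⟩ := hp
    refine ⟨G, I, e0, ?_⟩
    split_ifs with hf
    · refine ⟨h1, ?_⟩
      by_contra hn
      have h4 := (I.fresh _ h1.1 fun j hj hj' => hn ⟨j, hj, hj'⟩).2
      simp [hf] at h4
    · refine ⟨h1, i, h2, h3, ?_⟩
      rintro j hj hj'
      exact hf (hj' ▸ I.flag j (hj.trans h2.1))
  | te4 h =>
    simp only [h] at hp
    obtain ⟨h1, j, h2⟩ := hp
    have := I.len_le
    have := h2.1
    exact ⟨G, I, e0, h1, G.tailPos, ⟨le_rfl, I.tail⟩, j, by lia, h2⟩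
  | te5 h =>
    simp only [h] at hp
    obtain ⟨h1, i, h2, j, h3, h4⟩ := hp
    refine ⟨G, I, e0, h1, i, h2, j, h3, h4, ?_⟩
    refine (I.next_linkedAt h2.1 h2.2).imp_left ?_
    rintro ⟨h5, h6⟩
    have := h4.1
    exact ⟨h5, by lia⟩
  | te6 h =>
    simp only [h] at hp
    obtain ⟨h1, i, h2, j, h3, h4, h5⟩ := hp
    refine ⟨G, I, e0, ?_⟩
    split_ifs with hn
    · exact ⟨h1, i, h2, ⟨j, h3, h4⟩, h5.resolve_left fun h => hn h.1⟩
    · refine ⟨h1, j, ?_, h4.2⟩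
      rcases h5 with h5 | h5
      · exact h5.2.trans h2.1
      · refine absurd (I.ready_used _ (h5.ready I)) ?_
        rw [not_not.1 hn]
        exact I.none_notMem
  | te7 h =>
    simp only [h] at hp
    obtain ⟨h1, i, h2, ⟨j, h3, h4⟩, h5⟩ := hp
    obtain ⟨I', e'⟩ := I.setFlag (p := p) h5
    exact ⟨G, I', e', h1, i, h2, ⟨j, h3, h4⟩, h5, by simp [Shared.setFlag]⟩
  | te8 h =>
    simp only [h] at hp
    obtain ⟨h1, i, h2, ⟨j, h3, h4⟩, h5, h6⟩ := hp
    obtain ⟨G', I', e', h7⟩ := I.casTail (p := p) h2 h5 h6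
    exact ⟨G', I', e', h1.stable e', j, h3.trans h7, (h4.stable e').2⟩
  | te9 h =>
    simp only [h] at hp
    exact ⟨G, I, e0, ProcInv.enqDone hp.1 hp.2⟩
  | te10 h =>
    simp only [h] at hp
    obtain ⟨h1, i, h2, h3, h4⟩ := hp
    refine ⟨G, I, e0, ?_⟩
    split_ifs with hn
    · exact ⟨h1, i, h2, h3.resolve_left hn⟩
    · exact ⟨h1, i, h2, h4⟩
  | te11 h =>
    simp only [h] at hp
    obtain ⟨h1, i, h2, h5⟩ := hp
    obtain ⟨I', e'⟩ := I.setFlag (p := p) h5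
    exact ⟨G, I', e', h1, i, h2, h5, by simp [Shared.setFlag]⟩
  | te12 h =>
    simp only [h] at hp
    obtain ⟨h1, i, h2, h5, h6⟩ := hp
    obtain ⟨G', I', e', -⟩ := I.casTail (p := p) h2 h5 h6
    exact ⟨G', I', e', h1.stable e'⟩
  | te13 h =>
    simp only [h] at hp
    obtain ⟨h1, i, h2, h3⟩ := hp
    obtain ⟨G', I', e', h4⟩ := I.casNext (p := p) h2 h1.1 h3
    refine ⟨G', I', e', ?_⟩
    split_ifs with hn
    · exact ⟨h1.stable e', i, h2.stable I e', h4 hn⟩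
    · exact h1.stable e'
  | te14 h =>
    simp only [h] at hp
    obtain ⟨h1, i, h2, h5⟩ := hp
    obtain ⟨I', e'⟩ := I.setFlag (p := p) h5
    exact ⟨G, I', e', h1, i, h2, h5, by simp [Shared.setFlag]⟩
  | te15 h =>
    simp only [h] at hp
    obtain ⟨h1, i, h2, h5, h6⟩ := hp
    obtain ⟨G', I', e', h7⟩ := I.casTail (p := p) h2 h5 h6
    exact ⟨G', I', e', h1.stable e', i + 1, h7, (h5.stable e').2⟩
  | te16 h =>
    simp only [h] at hp
    exact ⟨G, I, e0, ProcInv.enqDone hp.1 hp.2⟩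
  | te17 h =>
    simp only [h] at hp
    exact ⟨G, I, e0, ProcInv.enqFailed hp⟩
  | td1 h =>
    simp only [h] at hp
    exact ⟨G, I, e0, hp, G.headPos, I.val_head, le_rfl, I.head, fun _ => rfl⟩
  | td2 h =>
    simp only [h] at hp
    obtain ⟨h1, i, h2⟩ := hp
    exact ⟨G, I, e0, h1, i, h2, G.tailPos, h2.2.1.trans I.head_le, le_rfl, I.tail⟩
  | td3 h =>
    simp only [h] at hp
    obtain ⟨h1, i, h2, h3⟩ := hp
    obtain ⟨I', e'⟩ := I.writeVal (p := p) h2.1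
    exact ⟨G, I', e', h1, i, h2, h3, by simp [Shared.setCell]⟩
  | td4 h =>
    simp only [h] at hp
    obtain ⟨h1, i, h2, h3, h4⟩ := hp
    refine ⟨G, I, e0, ?_⟩
    split_ifs with hn
    · exact ⟨h1, hn⟩
    · exact ⟨h1, i, h2, h3, h4, I.unserved h2 h4 (not_not.1 hn)⟩
  | td5 h =>
    simp only [h] at hp
    refine ⟨G, I, e0, ProcInv.deqReturn hp.1 fun hi => ?_⟩
    obtain ⟨x, hx, hx'⟩ := I.val_cell _ hp.1.1 hp.2
    rw [hx, hx'.resolve_left hi]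
  | td6 h =>
    simp only [h] at hp
    obtain ⟨h1, i, h2, ⟨k, h3, h4⟩, h5, h6⟩ := hp
    refine ⟨G, I, e0, ?_⟩
    split_ifs with hn
    · exact ⟨h1, i, h2, h5, h6⟩
    · refine ⟨h1, i, h2, h5, h6, ?_⟩
      rcases h3.lt_or_eq with h3 | rfl
      · exact Nat.succ_le_of_lt (h3.trans_le h4.1)
      · exact absurd (h2.2.2.1.symm.trans h4.2) hn
  | td7 h =>
    simp only [h] at hp
    obtain ⟨h1, i, h2, h5, h6⟩ := hp
    obtain ⟨G', I', e', h7⟩ := I.casHead (p := p) h1.1 h2 h5 h6 h2.2.2.1 (.inl ⟨rfl, rfl⟩)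
    refine ⟨G', I', e', ?_⟩
    split_ifs with hn
    · exact ⟨h1.stable e', h7 hn⟩
    · exact h1.stable e'
  | td8 h =>
    simp only [h] at hp
    exact ⟨G, I, e0, ProcInv.deqReturn hp.1 fun _ => hp.2⟩
  | td9 h =>
    simp only [h] at hp
    obtain ⟨h1, i, h2, h5, h6, h7⟩ := hp
    refine ⟨G, I, e0, h1, i, h2, h5, h6, h7, ?_⟩
    have := I.next i (by lia)
    rw [h2.2.2.1] at this
    exact this.symm
  | td10 h =>
    simp only [h] at hp
    obtain ⟨h1, i, h2, h5, h6, h7, h8⟩ := hp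
    exact ⟨G, I, e0, h1, i, h2, h5, h6, h7, h8, rfl⟩
  | td11 h =>
    simp only [h] at hp
    obtain ⟨h1, i, h2, h5, h6, h7, h8, h9⟩ := hp
    obtain ⟨G', I', e', h10⟩ := I.casHead (p := p) (x := .elem l.w) h1.1 h2 h5 h6 h8
      (.inr ⟨rfl, h7, by rw [h9]⟩)
    refine ⟨G', I', e', ?_⟩
    split_ifs with hn
    · exact ⟨h1.stable e', h10 hn⟩
    · exact h1.stable e'
  | td12 h =>
    simp only [h] at hp
    exact ⟨G, I, e0, ProcInv.deqReturn hp.1 fun _ => hp.2⟩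
  | td13 h =>
    simp only [h] at hp
    exact ⟨G, I, e0, ProcInv.deqFailed hp⟩
end steps

/-! ### The invariant along an execution -/

/-- The invariant of a configuration. -/
def Config.Inv {P : Type*} (c : Config P) (G : Ghost P) : Prop :=
  SharedInv c.sh G ∧ ∀ p, ProcInv p c.sh G (c.loc p)

theorem Config.Initial.inv {P : Type*} {c : Config P} {n : NodePtr} {a : LocPtr}
    (h : c.Initial n a) : ∃ G : Ghost P, c.Inv G ∧ G.tailPos = 0 ∧
      ∀ b ≠ a, G.val b = none := by
  classical
  refine ⟨⟨fun i => if i = 0 then n else none, 1, 0, 0, {n}, fun _ => none, {a}, fun _ => none,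
    fun b => if b = a then some c.sh.head.value else none, a⟩, ⟨?_, ?_⟩, rfl, ?_⟩
  · constructor <;> simp [h.initNode_ne, h.initNode_ne.symm, h.initNode_next, h.initNode_flag,
      h.initDQ_ne, h.tail, h.head_ptr, h.head_value, h.head_addr, h.annE, h.annD, h.usedNodes,
      h.usedLocs]
    lia
  · intro p
    simp [ProcInv, h.idle]
  · intro b hb
    simp [hb]

namespace Run
variable {P : Type*} (R : Run P)

/-- A coherent choice of ghost states along the execution `R`. -/
structure GhostRun (R : Run P) (G : ℕ → Ghost P) : Prop where
  inv : ∀ t, (R.conf t).Inv (G t)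
  evolves : ∀ t p e, R.act t = some (p, e) →
    Evolves p (R.conf t).sh (G t) (R.conf (t + 1)).sh (G (t + 1))
  stay : ∀ t, R.act t = none → G (t + 1) = G t
  tailPos_zero : (G 0).tailPos = 0
  val_zero : ∀ b ≠ (R.conf 0).sh.head.addr, (G 0).val b = none

theorem exists_ghostRun : ∃ G, R.GhostRun G := by
  obtain ⟨n, a, hi⟩ := R.init
  obtain ⟨G₀, h₀, h₁, h₂⟩ := hi.inv
  rw [← hi.head_addr] at h₂
  have step : ∀ t (G : Ghost P), (R.conf t).Inv G → ∃ G', (R.conf (t + 1)).Inv G' ∧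
      (∀ p e, R.act t = some (p, e) → Evolves p (R.conf t).sh G (R.conf (t + 1)).sh G') ∧
      (R.act t = none → G' = G) := by
    intro t G hG
    rcases hact : R.act t with _ | ⟨p, e⟩
    · exact ⟨G, by rwa [R.stay t hact], by simp, fun _ => rfl⟩
    · obtain ⟨h1, h2⟩ := R.step t p e hact
      obtain ⟨G', I', e', hp⟩ := hG.1.step (hG.2 p) h1
      refine ⟨G', ⟨I', fun q => ?_⟩, ?_, by simp⟩
      · by_cases hq : q = p
        · rwa [hq]
        · rw [h2 q hq]
          exact (hG.2 q).stable hG.1 hq e'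
      · rintro p' e'' h
        cases h
        exact e'
  choose f hf using step
  let S : ∀ t, { G : Ghost P // (R.conf t).Inv G } := fun t =>
    Nat.rec ⟨G₀, h₀⟩ (fun t G => ⟨f t G.1 G.2, (hf t G.1 G.2).1⟩) t
  exact ⟨fun t => (S t).1, fun t => (S t).2, fun t => (hf t _ (S t).2).2.1,
    fun t => (hf t _ (S t).2).2.2, h₁, h₂⟩

end Run

/-! ### The operation that a process is executing -/

/-- The stages of an operation: before and after it allocates its own node or location. -/
inductive Stage where
  | idle
  | enqPre
  | enqPost
  | deqPre
  | deqPost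

/-- The stage of a process; the subroutines are called before the allocation to help, and after it
to perform the own operation. -/
def Locals.stage (l : Locals) : Stage :=
  match l.pc with
  | .idle => .idle
  | .e1 | .e2 | .e3 => .enqPre
  | .e4 | .e5 | .e6 | .e7 | .e8 | .e9 => .enqPost
  | .d1 | .d2 | .d3 | .d4 => .deqPre
  | .d5 | .d6 | .d7 | .d8 => .deqPost
  | .te1 | .te2 | .te3 | .te4 | .te5 | .te6 | .te7 | .te8 | .te9 | .te10 | .te11 | .te12 | .te13
  | .te14 | .te15 | .te16 | .te17 => if l.selfish then .enqPost else .enqPre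
  | .td1 | .td2 | .td3 | .td4 | .td5 | .td6 | .td7 | .td8 | .td9 | .td10 | .td11 | .td12
  | .td13 => if l.selfish then .deqPost else .deqPre

section steps
variable {s s' : Shared} {l l' : Locals} {e : Option Event}

theorem LStep.stage (h : LStep s l e s' l') :
    (∃ v, e = some (.inv (.enq v)) ∧ l.stage = .idle ∧ l'.stage = .enqPre ∧ l'.v = v) ∨
    (e = some (.inv .deq) ∧ l.stage = .idle ∧ l'.stage = .deqPre) ∨
    (e = some (.res .done) ∧ l.pc = .e9 ∧ l'.stage = .idle) ∨
    (e = some (.res (.ret l.t)) ∧ l.pc = .d8 ∧ l'.stage = .idle) ∨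
    (e = none ∧ l.pc = .e3 ∧ l'.stage = .enqPost ∧ l'.v = l.v) ∨
    (e = none ∧ l.pc = .d4 ∧ l'.stage = .deqPost) ∨
    (e = none ∧ l.pc ≠ .e3 ∧ l.pc ≠ .d4 ∧ l'.stage = l.stage ∧ l'.v = l.v ∧
      l'.lnode = l.lnode ∧ l'.addr = l.addr) := by
  cases h <;> simp_all [Locals.stage, Locals.enqDone, Locals.enqFailed, Locals.deqReturn,
    Locals.deqFailed] <;> (try split_ifs) <;> simp_all

theorem LStep.usedNodes (h : LStep s l e s' l') :
    s'.usedNodes = s.usedNodes ∧ l.pc ≠ .e3 ∨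
    (l.pc = .e3 ∧ l'.pc = .e4 ∧ l'.lnode ∉ s.usedNodes ∧
      s'.usedNodes = insert l'.lnode s.usedNodes) := by
  cases h <;> simp_all [Shared.setValue, Shared.setNext, Shared.setFlag, Shared.setCell,
    Shared.casTail, Shared.casNext, Shared.casHead] <;> (try split_ifs) <;> simp_all

theorem LStep.usedLocs (h : LStep s l e s' l') :
    s'.usedLocs = s.usedLocs ∧ l.pc ≠ .d4 ∨
    (l.pc = .d4 ∧ l'.addr ∉ s.usedLocs ∧ s'.usedLocs = insert l'.addr s.usedLocs) := by
  cases h <;> simp_all [Shared.setValue, Shared.setNext, Shared.setFlag, Shared.setCell,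
    Shared.casTail, Shared.casNext, Shared.casHead] <;> (try split_ifs) <;> simp_all

theorem LStep.head (h : LStep s l e s' l') :
    s'.head = s.head ∨
    (l.pc = .td7 ∧ s.head = l.head ∧ s'.head = ⟨l.head.ptr, .bot, l.argAddr⟩) ∨
    (l.pc = .td11 ∧ s'.head.value = .elem l.w) := by
  cases h <;> simp_all [Shared.setValue, Shared.setNext, Shared.setFlag, Shared.setCell,
    Shared.casTail, Shared.casNext, Shared.casHead] <;> (try split_ifs) <;> simp_all

theorem LStep.shared_eq_of_td2 (h : LStep s l e s' l') (hp : l.pc = .td2) : s' = s := by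
  cases h <;> simp_all

/-- How `trytodequeue` proceeds from the reading of `g_Tail` to the CAS of line `td7`. -/
theorem LStep.afterTailRead (h : LStep s l e s' l')
    (hp : l'.pc = .td3 ∨ l'.pc = .td4 ∨ l'.pc = .td6 ∨ l'.pc = .td7) :
    l'.head = l.head ∧ l'.argAddr = l.argAddr ∧ (l'.pc = .td7 → l'.head.ptr = l'.tail) ∧
    (l.pc = .td2 ∧ l'.tail = s.tail ∨
      (l.pc = .td3 ∨ l.pc = .td4 ∨ l.pc = .td6) ∧ l'.tail = l.tail) := by
  cases h <;> simp_all [Locals.enqDone, Locals.enqFailed, Locals.deqReturn,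
    Locals.deqFailed] <;> grind
end steps

namespace Run
variable {P : Type*} (R : Run P)

theorem step_of_executes {R : Run P} {t : ℕ} {p : P} {ln : Line} (h : R.Executes t p ln) :
    ∃ e, R.act t = some (p, e) ∧
      LStep (R.conf t).sh ((R.conf t).loc p) e (R.conf (t + 1)).sh ((R.conf (t + 1)).loc p) :=
  let ⟨⟨e, he⟩, _⟩ := h
  ⟨e, he, (R.step t p e he).1⟩

theorem passive {R : Run P} {t : ℕ} {p : P} (h : ∀ e, R.act t ≠ some (p, e)) :
    (R.conf (t + 1)).loc p = (R.conf t).loc p ∧ (∀ e, R.history t ≠ some (p, e)) ∧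
      ∀ ln, ¬ R.Executes t p ln := by
  refine ⟨?_, ?_, fun ln hl => ?_⟩
  · rcases ha : R.act t with _ | ⟨q, e⟩
    · rw [R.stay t ha]
    · exact (R.step t q e ha).2 p (by rintro rfl; exact h e ha)
  · intro e he
    rcases ha : R.act t with _ | ⟨q, e'⟩
    · simp [history, ha] at he
    · simp only [history, ha, Option.bind_some, Option.map_eq_some_iff, Prod.mk.injEq] at he
      obtain ⟨_, _, rfl, _⟩ := he
      exact h e' ha
  · obtain ⟨⟨e, he⟩, _⟩ := hl
    exact h e he

theorem history_of_act {R : Run P} {t : ℕ} {p : P} {e : Option Event}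
    (h : R.act t = some (p, e)) : R.history t = e.map fun x => (p, x) := by
  simp [history, h]

theorem act_of_history {R : Run P} {t : ℕ} {p : P} {e : Event}
    (h : R.history t = some (p, e)) : R.act t = some (p, some e) := by
  rcases ha : R.act t with _ | ⟨q, _ | e'⟩ <;> simp_all [history]

theorem open_succ_iff {H : History P} {i : ℕ} {p : P} {t : ℕ} (hi : i < t) :
    H.Open i p (t + 1) ↔ H.Open i p t ∧ ∀ r, H t ≠ some (p, .res r) := by
  constructor
  · exact fun h => ⟨⟨hi, fun m hm hm' => h.2 m hm (hm'.trans (Nat.lt_succ_self _))⟩,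
      h.2 t hi (Nat.lt_succ_self _)⟩
  · rintro ⟨h1, h2⟩
    refine ⟨hi.trans (Nat.lt_succ_self _), fun m hm hm' => ?_⟩
    rcases Nat.lt_succ_iff_lt_or_eq.1 hm' with hm' | rfl
    exacts [h1.2 m hm hm', h2]

theorem Open.mono {H : History P} {i : ℕ} {p : P} {t k : ℕ} (h : H.Open i p t) (hi : i < k)
    (hk : k ≤ t) : H.Open i p k :=
  ⟨hi, fun m hm hm' => h.2 m hm (hm'.trans_le hk)⟩

/-- The relation between the stage of a process with local state `l` at time `t` and the operation
`op` that it invoked at time `i` and is executing. -/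
def StageInv (t : ℕ) (p : P) (l : Locals) (i : ℕ) (op : Op) : Prop :=
  match l.stage with
  | .idle => False
  | .enqPre => op = .enq l.v ∧ ∀ k, i < k → k < t → ¬ R.Executes k p .e3
  | .enqPost => op = .enq l.v ∧ ∃ k, i < k ∧ k < t ∧ R.Executes k p .e3 ∧
      ((R.conf (k + 1)).loc p).lnode = l.lnode
  | .deqPre => op = .deq ∧ ∀ k, i < k → k < t → ¬ R.Executes k p .d4
  | .deqPost => op = .deq ∧ ∃ k, i < k ∧ k < t ∧ R.Executes k p .d4 ∧
      ((R.conf (k + 1)).loc p).addr = l.addr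

/-- At time `t`, process `p` either is idle and has no open operation, or has a unique one. -/
def OpInv (t : ℕ) (p : P) : Prop :=
  (((R.conf t).loc p).stage = .idle ∧
    ∀ i op, R.history i = some (p, .inv op) → ¬ R.history.Open i p t) ∨
  ∃ i op, R.history i = some (p, .inv op) ∧ R.history.Open i p t ∧
    (∀ i' op', R.history i' = some (p, .inv op') → R.history.Open i' p t → i' = i) ∧
    R.StageInv t p ((R.conf t).loc p) i op

variable {R}

/-- Later steps of the same operation that do not allocate preserve the relation. -/
theorem StageInv.mono {t : ℕ} {p : P} {l l' : Locals} {i : ℕ} {op : Op}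
    (h : R.StageInv t p l i op) (hs : l'.stage = l.stage) (hv : l'.v = l.v)
    (hn : l'.lnode = l.lnode) (ha : l'.addr = l.addr)
    (he : ¬ R.Executes t p .e3) (hd : ¬ R.Executes t p .d4) : R.StageInv (t + 1) p l' i op := by
  have key : ∀ ln, ¬ R.Executes t p ln → (∀ k, i < k → k < t → ¬ R.Executes k p ln) →
      ∀ k, i < k → k < t + 1 → ¬ R.Executes k p ln := by
    intro ln h1 h2 k hk hk'
    rcases Nat.lt_succ_iff_lt_or_eq.1 hk' with hk' | rfl
    exacts [h2 k hk hk', h1]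
  unfold StageInv at h ⊢
  rw [hs, hv, hn, ha]
  cases hl : l.stage <;> simp only [hl] at h ⊢
  · exact ⟨h.1, key _ he h.2⟩
  · obtain ⟨h1, k, h2, h3, h4⟩ := h
    exact ⟨h1, k, h2, by lia, h4⟩
  · exact ⟨h.1, key _ hd h.2⟩
  · obtain ⟨h1, k, h2, h3, h4⟩ := h
    exact ⟨h1, k, h2, by lia, h4⟩

theorem opInv (R : Run P) (t : ℕ) (p : P) : R.OpInv t p := by
  induction t with
  | zero =>
    obtain ⟨n, a, hi⟩ := R.init
    exact Or.inl ⟨by simp [Locals.stage, hi.idle], fun i op _ h => absurd h.1 (by lia)⟩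
  | succ t ih =>
    -- an operation open at `t + 1` is open at `t` or invoked at `t`
    have hopen : ∀ i op, R.history i = some (p, .inv op) → R.history.Open i p (t + 1) →
        i = t ∨ R.history.Open i p t := by
      intro i op _ h
      rcases Nat.lt_succ_iff_lt_or_eq.1 h.1 with hi | rfl
      · exact Or.inr ((open_succ_iff hi).1 h).1
      · exact Or.inl rfl
    by_cases hact : ∀ e, R.act t ≠ some (p, e)
    · obtain ⟨h1, h2, h3⟩ := passive hact
      have h4 : ∀ i op, R.history i = some (p, .inv op) → R.history.Open i p (t + 1) →
          R.history.Open i p t := by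
        intro i op h h'
        refine (hopen i op h h').resolve_left ?_
        rintro rfl
        exact h2 _ h
      unfold OpInv
      rw [h1]
      rcases ih with ⟨ha, hb⟩ | ⟨i, op, ha, hb, hc, hd⟩
      · exact Or.inl ⟨ha, fun i op h h' => hb i op h (h4 i op h h')⟩
      · exact Or.inr ⟨i, op, ha, (open_succ_iff hb.1).2 ⟨hb, fun r => h2 _⟩,
          fun i' op' h h' => hc i' op' h (h4 i' op' h h'), hd.mono rfl rfl rfl rfl (h3 _) (h3 _)⟩
    · push Not at hact
      obtain ⟨e, hact⟩ := hact
      have hh := history_of_act hact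
      -- an operation that is invoked when the process is idle
      have hinv : ∀ op, e = some (.inv op) → ((R.conf t).loc p).stage = .idle →
          (R.StageInv (t + 1) p ((R.conf (t + 1)).loc p) t op) → R.OpInv (t + 1) p := by
        rintro op rfl hs hst
        refine Or.inr ⟨t, op, hh, ⟨by lia, fun m hm hm' => by lia⟩, ?_, hst⟩
        intro i' op' h h'
        refine (hopen i' op' h h').resolve_right fun h'' => ?_
        rcases ih with ⟨ha, hb⟩ | ⟨i, op, ha, hb, hc, hd⟩
        · exact hb _ _ h h''
        · simp [StageInv, hs] at hd
      -- a response
      have hres : ∀ r, e = some (.res r) → ((R.conf (t + 1)).loc p).stage = .idle →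
          R.OpInv (t + 1) p := by
        rintro r rfl hs
        refine Or.inl ⟨hs, fun i op h h' => ?_⟩
        rcases Nat.lt_succ_iff_lt_or_eq.1 h'.1 with hi | rfl
        · exact h'.2 t hi (by lia) r hh
        · rw [hh] at h; simp at h
      -- a step without a visible event
      have hnone : e = none → ((R.conf t).loc p).stage ≠ .idle → (∀ i op, i < t →
          R.StageInv t p ((R.conf t).loc p) i op →
          R.StageInv (t + 1) p ((R.conf (t + 1)).loc p) i op) → R.OpInv (t + 1) p := by
        rintro rfl hs hst
        rcases ih with ⟨ha, hb⟩ | ⟨i, op, ha, hb, hc, hd⟩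
        · exact absurd ha hs
        · refine Or.inr ⟨i, op, ha, (open_succ_iff hb.1).2 ⟨hb, by simp [hh]⟩, ?_, hst _ _ hb.1 hd⟩
          intro i' op' h h'
          refine hc i' op' h ((hopen i' op' h h').resolve_left ?_)
          rintro rfl
          simp [hh] at h
      rcases (R.step t p e hact).1.stage with ⟨v, h1, h2, h3, h4⟩ | ⟨h1, h2, h3⟩ | ⟨h1, h2, h3⟩ |
        ⟨h1, h2, h3⟩ | ⟨h1, h2, h3, h4⟩ | ⟨h1, h2, h3⟩ | ⟨h1, h2, h3, h4, h5, h6, h7⟩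
      · refine hinv _ h1 h2 ?_
        simp only [StageInv, h3, h4, true_and]
        intro k hk hk'; lia
      · refine hinv _ h1 h2 ?_
        simp only [StageInv, h3, true_and]
        intro k hk hk'; lia
      · exact hres _ h1 h3
      · exact hres _ h1 h3
      · refine hnone h1 (by simp [Locals.stage, h2]) fun i op hi hst => ?_
        simp only [StageInv, Locals.stage, h2] at hst
        simp only [StageInv, h3, h4]
        exact ⟨hst.1, t, hi, by lia, ⟨⟨e, hact⟩, h2⟩, rfl⟩
      · refine hnone h1 (by simp [Locals.stage, h2]) fun i op hi hst => ?_
        simp only [StageInv, Locals.stage, h2] at hst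
        simp only [StageInv, h3]
        exact ⟨hst.1, t, hi, by lia, ⟨⟨e, hact⟩, h2⟩, rfl⟩
      · rcases ih with ⟨ha, hb⟩ | ih'
        · subst h1
          refine Or.inl ⟨h4.trans ha, fun i op h h' => ?_⟩
          refine hb i op h ((hopen i op h h').resolve_left ?_)
          rintro rfl
          simp [hh] at h
        · refine hnone h1 ?_ fun i op hi hst =>
            hst.mono h4 h5 h6 h7 (fun h => h2 h.2) (fun h => h3 h.2)
          obtain ⟨i, op, -, -, -, hd⟩ := ih'
          intro hs
          simp [StageInv, hs] at hd

/-- The operation `i` is what the process is executing as long as it is open. -/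
theorem StageInv.of_open {t : ℕ} {p : P} {i : ℕ} {op : Op}
    (hi : R.history i = some (p, .inv op)) (ho : R.history.Open i p t) :
    R.StageInv t p ((R.conf t).loc p) i op := by
  rcases R.opInv t p with ⟨ha, hb⟩ | ⟨i', op', ha, hb, hc, hd⟩
  · exact absurd ho (hb i op hi)
  · obtain rfl := hc i op hi ho
    rw [hi] at ha
    simp only [Option.some.injEq, Prod.mk.injEq, Event.inv.injEq, true_and] at ha
    exact ha ▸ hd

/-! ### Allocations -/

theorem AllocNode.unique {i : ℕ} {p : P} {op : Op} {n n' : NodePtr}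
    (hi : R.history i = some (p, .inv op)) (h : R.AllocNode i p n) (h' : R.AllocNode i p n') :
    n = n' := by
  obtain ⟨k, h1, h2, h3⟩ := h
  obtain ⟨k', h1', h2', h3'⟩ := h'
  have s := StageInv.of_open hi h1
  have s' := StageInv.of_open hi h1'
  simp only [StageInv, Locals.stage, h2.2] at s
  simp only [StageInv, Locals.stage, h2'.2] at s'
  rcases lt_trichotomy k k' with hk | rfl | hk
  · exact absurd h2 (s'.2 k h1.1 hk)
  · rw [← h3, h3']
  · exact absurd h2' (s.2 k' h1'.1 hk)

theorem AllocLoc.unique {i : ℕ} {p : P} {op : Op} {a a' : LocPtr}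
    (hi : R.history i = some (p, .inv op)) (h : R.AllocLoc i p a) (h' : R.AllocLoc i p a') :
    a = a' := by
  obtain ⟨k, h1, h2, h3⟩ := h
  obtain ⟨k', h1', h2', h3'⟩ := h'
  have s := StageInv.of_open hi h1
  have s' := StageInv.of_open hi h1'
  simp only [StageInv, Locals.stage, h2.2] at s
  simp only [StageInv, Locals.stage, h2'.2] at s'
  rcases lt_trichotomy k k' with hk | rfl | hk
  · exact absurd h2 (s'.2 k h1.1 hk)
  · rw [← h3, h3']
  · exact absurd h2' (s.2 k' h1'.1 hk)

theorem usedNodes_mono (R : Run P) {t u : ℕ} (h : t ≤ u) :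
    (R.conf t).sh.usedNodes ⊆ (R.conf u).sh.usedNodes := by
  induction u, h using Nat.le_induction with
  | base => exact subset_rfl
  | succ u _ ih =>
    refine ih.trans ?_
    rcases ha : R.act u with _ | ⟨q, e⟩
    · rw [R.stay u ha]
    · rcases (R.step u q e ha).1.usedNodes with h | h
      · rw [h.1]
      · rw [h.2.2.2]; exact Set.subset_insert _ _

theorem usedLocs_mono (R : Run P) {t u : ℕ} (h : t ≤ u) :
    (R.conf t).sh.usedLocs ⊆ (R.conf u).sh.usedLocs := by
  induction u, h using Nat.le_induction with
  | base => exact subset_rfl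
  | succ u _ ih =>
    refine ih.trans ?_
    rcases ha : R.act u with _ | ⟨q, e⟩
    · rw [R.stay u ha]
    · rcases (R.step u q e ha).1.usedLocs with h | h
      · rw [h.1]
      · rw [h.2.2]; exact Set.subset_insert _ _

theorem Executes.e3_fresh {k : ℕ} {p : P} (h : R.Executes k p .e3) :
    ((R.conf (k + 1)).loc p).lnode ∉ (R.conf k).sh.usedNodes ∧
      ((R.conf (k + 1)).loc p).lnode ∈ (R.conf (k + 1)).sh.usedNodes := by
  obtain ⟨e, he, hs⟩ := step_of_executes h
  rcases hs.usedNodes with h' | h'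
  · exact absurd h.2 h'.2
  · rw [h'.2.2.2]
    exact ⟨h'.2.2.1, Set.mem_insert _ _⟩

theorem Executes.d4_fresh {k : ℕ} {p : P} (h : R.Executes k p .d4) :
    ((R.conf (k + 1)).loc p).addr ∉ (R.conf k).sh.usedLocs ∧
      ((R.conf (k + 1)).loc p).addr ∈ (R.conf (k + 1)).sh.usedLocs := by
  obtain ⟨e, he, hs⟩ := step_of_executes h
  rcases hs.usedLocs with h' | h'
  · exact absurd h.2 h'.2
  · rw [h'.2.2]
    exact ⟨h'.2.1, Set.mem_insert _ _⟩

theorem unique_of_fresh {α : Type*} {U : ℕ → Set α} (hU : ∀ t u, t ≤ u → U t ⊆ U u) {x : α}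
    {k k' : ℕ} (h1 : x ∉ U k) (h2 : x ∈ U (k + 1)) (h1' : x ∉ U k') (h2' : x ∈ U (k' + 1)) :
    k = k' := by
  rcases lt_trichotomy k k' with hk | rfl | hk
  · exact absurd (hU _ _ hk h2) h1'
  · rfl
  · exact absurd (hU _ _ hk h2') h1

theorem eq_of_open {t i i' : ℕ} {p : P} {op op' : Op} (hi : R.history i = some (p, .inv op))
    (hi' : R.history i' = some (p, .inv op')) (ho : R.history.Open i p t)
    (ho' : R.history.Open i' p t) : i = i' := by
  rcases R.opInv t p with ⟨ha, hb⟩ | ⟨j, _, ha, hb, hc, hd⟩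
  · exact absurd ho (hb i op hi)
  · rw [hc _ _ hi ho, hc _ _ hi' ho']

/-- Distinct operations allocate distinct nodes. -/
theorem AllocNode.inj {i i' : ℕ} {p p' : P} {op op' : Op} {n : NodePtr}
    (hi : R.history i = some (p, .inv op)) (hi' : R.history i' = some (p', .inv op'))
    (h : R.AllocNode i p n) (h' : R.AllocNode i' p' n) : i = i' := by
  obtain ⟨k, h1, h2, h3⟩ := h
  obtain ⟨k', h1', h2', h3'⟩ := h'
  have f := h2.e3_fresh
  have f' := h2'.e3_fresh
  rw [h3] at f
  rw [h3'] at f'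
  obtain rfl := unique_of_fresh (fun _ _ => R.usedNodes_mono) f.1 f.2 f'.1 f'.2
  obtain ⟨⟨e, he⟩, -⟩ := h2
  obtain ⟨⟨e', he'⟩, -⟩ := h2'
  obtain rfl : p = p' := by rw [he] at he'; simp at he'; exact he'.1
  exact eq_of_open hi hi' h1 h1'

/-- Distinct operations allocate distinct locations. -/
theorem AllocLoc.inj {i i' : ℕ} {p p' : P} {op op' : Op} {a : LocPtr}
    (hi : R.history i = some (p, .inv op)) (hi' : R.history i' = some (p', .inv op'))
    (h : R.AllocLoc i p a) (h' : R.AllocLoc i' p' a) : i = i' := by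
  obtain ⟨k, h1, h2, h3⟩ := h
  obtain ⟨k', h1', h2', h3'⟩ := h'
  have f := h2.d4_fresh
  have f' := h2'.d4_fresh
  rw [h3] at f
  rw [h3'] at f'
  obtain rfl := unique_of_fresh (fun _ _ => R.usedLocs_mono) f.1 f.2 f'.1 f'.2
  obtain ⟨⟨e, he⟩, -⟩ := h2
  obtain ⟨⟨e', he'⟩, -⟩ := h2'
  obtain rfl : p = p' := by rw [he] at he'; simp at he'; exact he'.1
  exact eq_of_open hi hi' h1 h1'

/-- A property that holds at time `t` but not at time `0` starts to hold at some step. -/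
theorem exists_first {Q : ℕ → Prop} {t : ℕ} (h0 : ¬ Q 0) (ht : Q t) :
    ∃ u < t, Q (u + 1) ∧ ∀ s ≤ u, ¬ Q s := by
  classical
  have hex : ∃ t, Q t := ⟨t, ht⟩
  have h1 : Nat.find hex ≠ 0 := fun h => h0 (h ▸ Nat.find_spec hex)
  obtain ⟨u, hu⟩ := Nat.exists_eq_succ_of_ne_zero h1
  refine ⟨u, ?_, (congrArg Q hu).mp (Nat.find_spec hex), fun s hs => Nat.find_min hex (by lia)⟩
  have := Nat.find_min' hex ht
  lia

theorem exists_allocNode {t : ℕ} {n : NodePtr} (h0 : n ∉ (R.conf 0).sh.usedNodes)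
    (ht : n ∈ (R.conf t).sh.usedNodes) :
    ∃ i p v, R.history i = some (p, .inv (.enq v)) ∧ R.AllocNode i p n := by
  obtain ⟨k, -, h1, h2⟩ := exists_first (Q := fun t => n ∈ (R.conf t).sh.usedNodes) h0 ht
  have h2 := h2 k le_rfl
  rcases ha : R.act k with _ | ⟨p, e⟩
  · rw [R.stay k ha] at h1; exact absurd h1 h2
  · rcases (R.step k p e ha).1.usedNodes with h | h
    · rw [h.1] at h1; exact absurd h1 h2
    · rw [h.2.2.2] at h1
      have hn := (Set.mem_insert_iff.1 h1).resolve_right h2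
      rcases R.opInv k p with ⟨hs, -⟩ | ⟨i, op, h3, h4, -, h5⟩
      · simp [Locals.stage, h.1] at hs
      · simp only [StageInv, Locals.stage, h.1] at h5
        exact ⟨i, p, _, h5.1 ▸ h3, k, h4, ⟨⟨e, ha⟩, h.1⟩, hn.symm⟩

theorem exists_allocLoc {t : ℕ} {a : LocPtr} (h0 : a ∉ (R.conf 0).sh.usedLocs)
    (ht : a ∈ (R.conf t).sh.usedLocs) :
    ∃ i p, R.history i = some (p, .inv .deq) ∧ R.AllocLoc i p a := by
  obtain ⟨k, -, h1, h2⟩ := exists_first (Q := fun t => a ∈ (R.conf t).sh.usedLocs) h0 ht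
  have h2 := h2 k le_rfl
  rcases ha : R.act k with _ | ⟨p, e⟩
  · rw [R.stay k ha] at h1; exact absurd h1 h2
  · rcases (R.step k p e ha).1.usedLocs with h | h
    · rw [h.1] at h1; exact absurd h1 h2
    · rw [h.2.2] at h1
      have hn := (Set.mem_insert_iff.1 h1).resolve_right h2
      rcases R.opInv k p with ⟨hs, -⟩ | ⟨i, op, h3, h4, -, h5⟩
      · simp [Locals.stage, h.1] at hs
      · simp only [StageInv, Locals.stage, h.1] at h5
        exact ⟨i, p, h5.1 ▸ h3, k, h4, ⟨⟨e, ha⟩, h.1⟩, hn.symm⟩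

/-! ### The last reading of the tail before an empty dequeue -/

/-- Between its last reading of `g_Tail` and the CAS of line `td7`, a process does not change its
copy of `g_Head` nor the location it serves, and does not execute another such CAS. -/
theorem exists_tailRead (R : Run P) (t : ℕ) (p : P)
    (h : ((R.conf t).loc p).pc = .td3 ∨ ((R.conf t).loc p).pc = .td4 ∨
      ((R.conf t).loc p).pc = .td6 ∨ ((R.conf t).loc p).pc = .td7) :
    ∃ t₀ < t, R.Executes t₀ p .td2 ∧
      (∀ m, t₀ < m → m < t → ¬ R.Executes m p .td2 ∧ ¬ R.Executes m p .td7) ∧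
      ((R.conf t₀).loc p).head = ((R.conf t).loc p).head ∧
      ((R.conf t₀).loc p).argAddr = ((R.conf t).loc p).argAddr ∧
      (R.conf t₀).sh.tail = ((R.conf t).loc p).tail ∧
      (((R.conf t).loc p).pc = .td7 → ((R.conf t).loc p).head.ptr = ((R.conf t).loc p).tail) := by
  induction t with
  | zero =>
    obtain ⟨n, a, hi⟩ := R.init
    simp [hi.idle] at h
  | succ t ih =>
    by_cases hact : ∀ e, R.act t ≠ some (p, e)
    · obtain ⟨h1, -, h3⟩ := passive hact
      rw [h1] at h ⊢
      obtain ⟨t₀, ht, h4, h5, h6⟩ := ih h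
      refine ⟨t₀, by lia, h4, fun m hm hm' => ?_, h6⟩
      rcases Nat.lt_succ_iff_lt_or_eq.1 hm' with hm' | rfl
      exacts [h5 m hm hm', ⟨h3 _, h3 _⟩]
    · push Not at hact
      obtain ⟨e, hact⟩ := hact
      obtain ⟨h1, h2, h3, h4⟩ := (R.step t p e hact).1.afterTailRead h
      rcases h4 with ⟨h4, h5⟩ | ⟨h4, h5⟩
      · exact ⟨t, by lia, ⟨⟨e, hact⟩, h4⟩, fun m hm hm' => by lia, h1.symm, h2.symm, h5.symm, h3⟩
      · obtain ⟨t₀, ht, g1, g2, g3, g4, g5, -⟩ := ih (by tauto)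
        refine ⟨t₀, by lia, g1, fun m hm hm' => ?_, g3.trans h1.symm, g4.trans h2.symm,
          g5.trans h5.symm, h3⟩
        rcases Nat.lt_succ_iff_lt_or_eq.1 hm' with hm' | rfl
        · exact g2 m hm hm'
        · constructor <;> rintro ⟨-, h6⟩ <;> simp [h6] at h4

end Run

namespace Run
variable {P : Type*} {R : Run P}

/-! ### How nodes and locations are reached by the tail and the head -/

variable {G : ℕ → Ghost P}

theorem GhostRun.stay_or_evolves (hG : R.GhostRun G) (t : ℕ) :
    (R.conf (t + 1) = R.conf t ∧ G (t + 1) = G t) ∨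
      ∃ p, Evolves p (R.conf t).sh (G t) (R.conf (t + 1)).sh (G (t + 1)) := by
  rcases ha : R.act t with _ | ⟨p, e⟩
  · exact Or.inl ⟨R.stay t ha, hG.stay t ha⟩
  · exact Or.inr ⟨p, hG.evolves t p e ha⟩

theorem GhostRun.val_mono (hG : R.GhostRun G) {t u : ℕ} (h : t ≤ u) {a : LocPtr} {x : Cell}
    (hx : (G t).val a = some x) : (G u).val a = some x := by
  induction u, h using Nat.le_induction with
  | base => exact hx
  | succ u _ ih =>
    rcases hG.stay_or_evolves u with h | ⟨p, h⟩
    · rwa [h.2]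
    · exact h.val ih

theorem GhostRun.nodeAt_mono (hG : R.GhostRun G) {t u : ℕ} (h : t ≤ u) {i : ℕ}
    (hi : i ≤ (G t).tailPos) : i ≤ (G u).tailPos ∧ (G u).nodeAt i = (G t).nodeAt i := by
  induction u, h using Nat.le_induction with
  | base => exact ⟨hi, rfl⟩
  | succ u _ ih =>
    rcases hG.stay_or_evolves u with h | ⟨p, h⟩
    · rwa [h.2]
    · exact ⟨ih.1.trans h.tail_le, (h.nodeAt _ (ih.1.trans_lt (hG.inv u).1.tail_lt)).trans ih.2⟩

theorem GhostRun.owner_mono (hG : R.GhostRun G) {t u : ℕ} (h : t ≤ u) {n : NodePtr}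
    (hn : n ∈ (R.conf t).sh.usedNodes) : (G u).owner n = (G t).owner n := by
  induction u, h using Nat.le_induction with
  | base => rfl
  | succ u hu ih =>
    rcases hG.stay_or_evolves u with h | ⟨p, h⟩
    · rwa [h.2]
    · exact (h.owner n (R.usedNodes_mono hu hn)).trans ih

theorem GhostRun.tail_used (hG : R.GhostRun G) (t : ℕ) :
    (R.conf t).sh.tail ∈ (R.conf t).sh.usedNodes := by
  have I := (hG.inv t).1
  rw [← I.tail]
  exact I.ready_used _ (I.node_ready _ I.tail_lt)

theorem GhostRun.head_used (hG : R.GhostRun G) (t : ℕ) :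
    (R.conf t).sh.head.addr ∈ (R.conf t).sh.usedLocs := by
  have I := (hG.inv t).1
  exact I.readyLoc_used _ (I.val_ready _ _ I.val_head)

theorem GhostRun.exists_tail_of_reached (hG : R.GhostRun G) {t : ℕ} {n : NodePtr}
    (h : Reached (G t) n) : ∃ s ≤ t, (R.conf s).sh.tail = n := by
  induction t with
  | zero =>
    obtain ⟨j, hj, rfl⟩ := h
    refine ⟨0, le_rfl, ?_⟩
    rw [← (hG.inv 0).1.tail]
    rw [hG.tailPos_zero] at hj ⊢
    rw [Nat.le_zero.1 hj]
  | succ t ih =>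
    obtain ⟨j, hj, rfl⟩ := h
    by_cases hjt : j ≤ (G t).tailPos
    · obtain ⟨s, hs, hs'⟩ := ih ⟨j, hjt, (hG.nodeAt_mono (Nat.le_succ t) hjt).2.symm⟩
      exact ⟨s, by lia, hs'⟩
    · have h1 : (G (t + 1)).tailPos ≤ (G t).tailPos + 1 := by
        rcases hG.stay_or_evolves t with h | ⟨p, h⟩
        · rw [h.2]; exact Nat.le_succ _
        · exact h.tail_le_succ
      obtain rfl : j = (G (t + 1)).tailPos := by lia
      exact ⟨t + 1, le_rfl, (hG.inv (t + 1)).1.tail.symm⟩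

theorem exists_firstTail {n : NodePtr} {t : ℕ} (h : (R.conf t).sh.tail = n)
    (h0 : (R.conf 0).sh.tail ≠ n) : ∃ u < t, R.FirstTail n u :=
  exists_first (Q := fun t => (R.conf t).sh.tail = n) h0 h

theorem FirstTail.unique {n : NodePtr} {t u : ℕ} (h : R.FirstTail n t) (h' : R.FirstTail n u) :
    t = u := by
  rcases lt_trichotomy t u with htu | rfl | htu
  · exact absurd h.1 (h'.2 _ htu)
  · rfl
  · exact absurd h'.1 (h.2 _ htu)

theorem FirstHead.unique {a : LocPtr} {t u : ℕ} (h : R.FirstHead a t) (h' : R.FirstHead a u) :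
    t = u := by
  rcases lt_trichotomy t u with htu | rfl | htu
  · exact absurd h.1 (h'.2 _ htu)
  · rfl
  · exact absurd h'.1 (h.2 _ htu)

theorem FirstTail.tailPos (hG : R.GhostRun G) {n : NodePtr} {t : ℕ} (h : R.FirstTail n t) :
    (G (t + 1)).tailPos = (G t).tailPos + 1 ∧ (G (t + 1)).nodeAt ((G t).tailPos + 1) = n := by
  have h1 := h.2 t le_rfl
  have I := (hG.inv t).1
  have I' := (hG.inv (t + 1)).1
  rcases hG.stay_or_evolves t with h2 | ⟨p, h2⟩
  · exact absurd (h2.1 ▸ h.1) h1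
  · have h3 : (G (t + 1)).tailPos = (G t).tailPos + 1 := by
      by_contra h3
      have h4 : (G (t + 1)).tailPos = (G t).tailPos := by
        have := h2.tail_le
        have := h2.tail_le_succ
        lia
      apply h1
      rw [← h.1, ← I.tail, ← I'.tail, h4, h2.nodeAt _ I.tail_lt]
    refine ⟨h3, ?_⟩
    rw [← h3, I'.tail, h.1]

theorem GhostRun.firstTail_of_tailPos (hG : R.GhostRun G) {t : ℕ}
    (h : (G (t + 1)).tailPos = (G t).tailPos + 1) :
    R.FirstTail (R.conf (t + 1)).sh.tail t := by
  refine ⟨rfl, fun s hs hst => ?_⟩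
  have I := (hG.inv (t + 1)).1
  obtain ⟨h1, -⟩ := hG.nodeAt_mono hs le_rfl
  obtain ⟨h2, h3⟩ := hG.nodeAt_mono (hs.trans (Nat.le_succ t)) le_rfl
  rw [← I.tail, ← (hG.inv s).1.tail, ← h3] at hst
  have := I.inj _ (h2.trans_lt I.tail_lt) _ I.tail_lt hst
  lia

/-- Each location that has been in `g_Head`, except the initial one, entered it at some step,
together with its value. -/
theorem GhostRun.exists_firstHead (hG : R.GhostRun G) {a : LocPtr} {x : Cell} {t : ℕ}
    (ha : a ≠ (R.conf 0).sh.head.addr) (h : (G t).val a = some x) :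
    ∃ u < t, R.FirstHead a u ∧ (R.conf (u + 1)).sh.head.value = x := by
  induction t with
  | zero => rw [hG.val_zero a ha] at h; simp at h
  | succ t ih =>
    by_cases hv : (G t).val a = some x
    · obtain ⟨u, hu, hu'⟩ := ih hv
      exact ⟨u, by lia, hu'⟩
    · have hn : (G t).val a = none := by
        by_contra hn
        obtain ⟨y, hy⟩ := Option.ne_none_iff_exists'.1 hn
        rw [hG.val_mono (Nat.le_succ t) hy] at h
        exact hv (hy.trans h)
      have key : (R.conf (t + 1)).sh.head.addr = a ∧ (R.conf (t + 1)).sh.head.value = x := by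
        rcases hG.stay_or_evolves t with h2 | ⟨p, h2⟩
        · exact absurd (h2.2 ▸ h) hv
        · rcases h2.head with h3 | h3
          · exact absurd (h3.2.1 ▸ h) hv
          · rw [h3.2.1] at h
            by_cases hh : (R.conf (t + 1)).sh.head.addr = a
            · rw [← hh, Function.update_self] at h
              exact ⟨hh, Option.some.inj h⟩
            · rw [Function.update_of_ne (Ne.symm hh)] at h
              exact absurd h hv
      refine ⟨t, Nat.lt_succ_self t, ⟨key.1, fun s hs hsa => ?_⟩, key.2⟩
      have h4 := hG.val_mono hs (hG.inv s).1.val_head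
      rw [hsa, hn] at h4
      simp at h4

/-- What a step does that makes `g_Head.addr` point to a new location. -/
theorem FirstHead.change (hG : R.GhostRun G) {a : LocPtr} {t : ℕ} (h : R.FirstHead a t) :
    (G (t + 1)).tailPos = (G t).tailPos ∧
      (((R.conf (t + 1)).sh.head.value = .bot ∧ (G (t + 1)).headPos = (G t).headPos) ∨
        ((G (t + 1)).headPos = (G t).headPos + 1 ∧ (G t).headPos + 1 ≤ (G t).tailPos ∧
          (R.conf (t + 1)).sh.head.value =
            .elem ((R.conf t).sh.node ((G t).nodeAt ((G t).headPos + 1))).value)) := by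
  have h1 := h.2 t le_rfl
  rcases hG.stay_or_evolves t with h2 | ⟨p, h2⟩
  · exact absurd (h2.1 ▸ h.1) h1
  · rcases h2.head with h3 | h3
    · exact absurd (h3.1 ▸ h.1) h1
    · exact h3.2.2

/-- The field `g_Head.addr` never returns to a former value. -/
theorem GhostRun.head_addr_eq (hG : R.GhostRun G) {t u : ℕ} {b : LocPtr} {x : Cell} (h : t ≤ u)
    (hb : (G t).val b = some x) (hu : (R.conf u).sh.head.addr = b) :
    (R.conf t).sh.head.addr = b := by
  induction u, h using Nat.le_induction with
  | base => exact hu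
  | succ u hu' ih =>
    refine ih ?_
    rcases hG.stay_or_evolves u with h2 | ⟨p, h2⟩
    · rw [← hu, h2.1]
    · rcases h2.head with h3 | h3
      · rw [← hu, h3.1]
      · rw [hu, hG.val_mono hu' hb] at h3
        simp at h3

/-! ### Dequeues of an empty queue -/

/-- When a dequeue is served with `⊥`, the queue was empty when the serving process last read
`g_Tail`: `g_Head` did not change from its reading before until the CAS, and its node was the one
read from `g_Tail`. -/
theorem FirstHead.exists_tailRead (hG : R.GhostRun G) {a : LocPtr} {u : ℕ} (h : R.FirstHead a u)
    (hb : (R.conf (u + 1)).sh.head.value = .bot) :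
    ∃ t q, t < u ∧ R.Executes u q .td7 ∧ R.Executes t q .td2 ∧
      (∀ m, t < m → m < u → ¬ R.Executes m q .td2 ∧ ¬ R.Executes m q .td7) ∧
      ((R.conf t).loc q).argAddr = a ∧ (G t).headPos = (G t).tailPos := by
  have h1 := h.2 u le_rfl
  rcases ha : R.act u with _ | ⟨q, e⟩
  · exact absurd (R.stay u ha ▸ h.1) h1
  · rcases (R.step u q e ha).1.head with h2 | ⟨h2, h3, h4⟩ | ⟨h2, h3⟩
    · exact absurd (h2 ▸ h.1) h1
    · obtain ⟨t, ht, g1, g2, g3, g4, g5, g6⟩ := R.exists_tailRead u q (by simp [h2])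
      refine ⟨t, q, ht, ⟨⟨e, ha⟩, h2⟩, g1, g2, ?_, ?_⟩
      · rw [g4, ← h.1, h4]
      · have hp := (hG.inv t).2 q
        have I := (hG.inv t).1
        simp only [ProcInv, g1.2] at hp
        obtain ⟨-, i, f1, f2, f3, f4⟩ := hp
        have f5 := f4 (hG.head_addr_eq ht.le f1 (by rw [h3, g3]))
        refine I.inj _ (I.head_le.trans_lt I.tail_lt) _ I.tail_lt ?_
        rw [I.head, I.tail, f5, g3, g6 h2, g5]
    · rw [h3] at hb; simp at hb

theorem LastTailRead.unique {u t t' : ℕ} (h : R.LastTailRead u t) (h' : R.LastTailRead u t') :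
    t = t' := by
  obtain ⟨q, e, h1, h2, h3, h4⟩ := h
  obtain ⟨q', e', h1', h2', h3', h4'⟩ := h'
  obtain rfl : q = q' := by rw [h1] at h1'; simp at h1'; exact h1'.1
  rcases lt_trichotomy t t' with ht | rfl | ht
  · exact absurd h3' (h4 _ ht h2')
  · rfl
  · exact absurd h3 (h4' _ ht h2)

/-- The last reading of `g_Tail` determines the CAS that follows. -/
theorem LastTailRead.eq_of_td7 {u u' t : ℕ} (h : R.LastTailRead u t) (h' : R.LastTailRead u' t)
    {q q' : P} (hu : R.Executes u q .td7) (hu' : R.Executes u' q' .td7) : u = u' := by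
  obtain ⟨p, e, h1, h2, h3, h4⟩ := h
  obtain ⟨p', e', h1', h2', h3', h4'⟩ := h'
  obtain ⟨⟨_, h5⟩, h6⟩ := hu
  obtain ⟨⟨_, h5'⟩, h6'⟩ := hu'
  obtain ⟨⟨_, h7⟩, -⟩ := id h3
  obtain ⟨⟨_, h7'⟩, -⟩ := id h3'
  obtain rfl : p = p' := by rw [h7] at h7'; simp at h7'; exact h7'.1
  obtain rfl : p = q := by rw [h1] at h5; simp at h5; exact h5.1
  obtain rfl : p = q' := by rw [h1'] at h5'; simp at h5'; exact h5'.1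
  -- two CAS steps of one process are separated by a reading of `g_Tail`
  have key : ∀ v w, t < v → v < w → R.Executes v p .td7 → ((R.conf w).loc p).pc = .td7 →
      (∀ m, t < m → m < w → ¬ R.Executes m p .td2) → False := by
    intro v w hv hvw hev hpc hm
    obtain ⟨t₀, ht, g1, g2, -⟩ := R.exists_tailRead w p (by simp [hpc])
    have ht₀ : t₀ ≤ t := by
      by_contra hlt
      exact hm t₀ (by lia) ht g1
    exact (g2 v (by lia) hvw).2 hev
  rcases lt_trichotomy u u' with hlt | rfl | hlt
  · exact (key u u' h2 hlt ⟨⟨_, h5⟩, h6⟩ h6' h4').elim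
  · rfl
  · exact (key u' u h2' hlt ⟨⟨_, h5'⟩, h6'⟩ h6 h4).elim

/-! ### The completion -/

theorem AllocNode.ne_tail_zero (hG : R.GhostRun G) {i : ℕ} {p : P} {n : NodePtr}
    (h : R.AllocNode i p n) : (R.conf 0).sh.tail ≠ n := by
  obtain ⟨k, -, h2, rfl⟩ := h
  intro hn
  exact h2.e3_fresh.1 (R.usedNodes_mono (Nat.zero_le k) (hn ▸ hG.tail_used 0))

theorem AllocLoc.ne_addr_zero (hG : R.GhostRun G) {i : ℕ} {p : P} {a : LocPtr}
    (h : R.AllocLoc i p a) : a ≠ (R.conf 0).sh.head.addr := by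
  obtain ⟨k, -, h2, rfl⟩ := h
  intro hn
  exact h2.d4_fresh.1 (R.usedLocs_mono (Nat.zero_le k) (hn ▸ hG.head_used 0))

/-- A completed enqueue returns `done` after `g_Tail` has reached its node. -/
theorem GhostRun.response_enq (hG : R.GhostRun G) {i j : ℕ} {p : P} {v : ℤ} {r : Resp}
    (hi : R.history i = some (p, .inv (.enq v))) (h : R.history.RespondsAt i p r j) :
    r = .done ∧ ∃ n t, R.AllocNode i p n ∧ R.FirstTail n t ∧ t < j := by
  have hs := StageInv.of_open hi h.1
  have hact := act_of_history h.2
  have hp := (hG.inv j).2 p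
  rcases (R.step j p _ hact).1.stage with h1 | h1 | ⟨h1, h2, -⟩ | ⟨h1, h2, -⟩ | h1 | h1 | h1
  · simp at h1
  · simp at h1
  · simp only [StageInv, Locals.stage, h2] at hs
    simp only [ProcInv, h2] at hp
    obtain ⟨-, k, g1, g2, g3, g4⟩ := hs
    have ha : R.AllocNode i p ((R.conf j).loc p).lnode := ⟨k, Open.mono h.1 g1 g2.le, g3, g4⟩
    obtain ⟨s, hs, hs'⟩ := hG.exists_tail_of_reached hp
    obtain ⟨t, ht, ht'⟩ := exists_firstTail hs' (ha.ne_tail_zero hG)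
    exact ⟨by simpa using h1, _, t, ha, ht', by lia⟩
  · simp [StageInv, Locals.stage, h2] at hs
  · simp at h1
  · simp at h1
  · simp at h1

/-- A completed dequeue returns the value that `g_Head` had when `g_Head.addr` first was its
location. -/
theorem GhostRun.response_deq (hG : R.GhostRun G) {i j : ℕ} {p : P} {r : Resp}
    (hi : R.history i = some (p, .inv .deq)) (h : R.history.RespondsAt i p r j) :
    ∃ a t, R.AllocLoc i p a ∧ R.FirstHead a t ∧
      r = .ret (R.conf (t + 1)).sh.head.value ∧ t < j := by
  have hs := StageInv.of_open hi h.1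
  have hact := act_of_history h.2
  have hp := (hG.inv j).2 p
  rcases (R.step j p _ hact).1.stage with h1 | h1 | ⟨h1, h2, -⟩ | ⟨h1, h2, -⟩ | h1 | h1 | h1
  · simp at h1
  · simp at h1
  · simp [StageInv, Locals.stage, h2] at hs
  · simp only [StageInv, Locals.stage, h2] at hs
    simp only [ProcInv, h2] at hp
    obtain ⟨-, k, g1, g2, g3, g4⟩ := hs
    have ha : R.AllocLoc i p ((R.conf j).loc p).addr := ⟨k, Open.mono h.1 g1 g2.le, g3, g4⟩
    obtain ⟨t, ht, ht', hv⟩ := hG.exists_firstHead (ha.ne_addr_zero hG) hp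
    exact ⟨_, t, ha, ht', by rw [hv]; simpa using h1, ht⟩
  · simp at h1
  · simp at h1
  · simp at h1

theorem AddedResponse.unique {i : ℕ} {p : P} {op : Op} {r r' : Resp}
    (hi : R.history i = some (p, .inv op)) (h : R.AddedResponse i p op r)
    (h' : R.AddedResponse i p op r') : r = r' := by
  cases op with
  | enq v => rw [h.2, h'.2]
  | deq =>
    obtain ⟨a, t, h1, h2, rfl⟩ := h
    obtain ⟨a', t', h1', h2', rfl⟩ := h'
    obtain rfl := h1.unique hi h1'
    rw [h2.unique h2']

theorem GhostRun.addedResponse (hG : R.GhostRun G) {i j : ℕ} {p : P} {op : Op} {r : Resp}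
    (hi : R.history i = some (p, .inv op)) (h : R.history.RespondsAt i p r j) :
    R.AddedResponse i p op r := by
  cases op with
  | enq v =>
    obtain ⟨hr, n, t, h1, h2, -⟩ := hG.response_enq hi h
    exact ⟨⟨n, t, h1, h2⟩, hr⟩
  | deq =>
    obtain ⟨a, t, h1, h2, h3, -⟩ := hG.response_deq hi h
    exact ⟨a, t, h1, h2, h3⟩

theorem GhostRun.mem_completion_iff (hG : R.GhostRun G) {o : OpRec P} :
    o ∈ R.completion ↔ R.history o.inv = some (o.proc, .inv o.op) ∧
      R.AddedResponse o.inv o.proc o.op o.resp := by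
  constructor
  · rintro ⟨h1, ⟨j, h2⟩ | h2⟩
    exacts [⟨h1, hG.addedResponse h1 h2⟩, ⟨h1, h2.2⟩]
  · rintro ⟨h1, h2⟩
    refine ⟨h1, ?_⟩
    by_cases h : ∃ r j, R.history.RespondsAt o.inv o.proc r j
    · obtain ⟨r, j, h⟩ := h
      have := (hG.addedResponse h1 h).unique h1 h2
      exact Or.inl ⟨j, this ▸ h⟩
    · exact Or.inr ⟨h, h2⟩

theorem GhostRun.completion_unique (hG : R.GhostRun G) {o o' : OpRec P} (h : o ∈ R.completion)
    (h' : o' ∈ R.completion) (hi : o.inv = o'.inv) : o = o' := by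
  rw [hG.mem_completion_iff] at h h'
  obtain ⟨i, p, op, r⟩ := o
  obtain ⟨i', p', op', r'⟩ := o'
  obtain rfl : i = i' := hi
  simp only at h h'
  have h1 := h.1.symm.trans h'.1
  simp only [Option.some.injEq, Prod.mk.injEq, Event.inv.injEq] at h1
  obtain ⟨rfl, rfl⟩ := h1
  rw [h.2.unique h.1 h'.2]

theorem GhostRun.isCompletion (hG : R.GhostRun G) : IsCompletion R.history R.completion where
  invoked _ h := h.1
  unique _ h _ h' hi := hG.completion_unique h h' hi
  response o h r j hr := by
    rw [hG.mem_completion_iff] at h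
    exact h.2.unique h.1 (hG.addedResponse h.1 hr)
  completed i p op r j hi hr := ⟨hi, Or.inl ⟨j, hr⟩⟩

/-! ### The linearization points -/

theorem GhostRun.existsUnique_linPoint (hG : R.GhostRun G) {o : OpRec P}
    (ho : o ∈ R.completion) : ∃! t, R.LinPoint o t := by
  rw [hG.mem_completion_iff] at ho
  obtain ⟨i, p, op, r⟩ := o
  obtain ⟨hi, hr⟩ := ho
  cases op with
  | enq v =>
    obtain ⟨⟨n, t, h1, h2⟩, -⟩ := hr
    refine ⟨t, ⟨n, h1, h2⟩, ?_⟩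
    rintro t' ⟨n', h1', h2'⟩
    obtain rfl := h1.unique hi h1'
    exact h2'.unique h2
  | deq =>
    obtain ⟨a, u, h1, h2, h3⟩ := hr
    simp only at h3
    by_cases hb : r = .ret .bot
    · have hb' : (R.conf (u + 1)).sh.head.value = .bot := by
        rw [hb] at h3; simpa using h3.symm
      obtain ⟨t, q, g1, ⟨⟨e, g2⟩, -⟩, g3, g4, -⟩ := h2.exists_tailRead hG hb'
      have hl : R.LastTailRead u t := ⟨q, e, g2, g1, g3, fun m hm hm' => (g4 m hm hm').1⟩
      refine ⟨t, ⟨a, u, h1, h2, Or.inr ⟨hb, hl⟩⟩, ?_⟩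
      rintro t' ⟨a', u', h1', h2', ⟨h3', -⟩ | ⟨-, h3'⟩⟩
      · exact absurd hb h3'
      · obtain rfl := h1.unique hi h1'
        obtain rfl := h2.unique h2'
        exact h3'.unique hl
    · refine ⟨u, ⟨a, u, h1, h2, Or.inl ⟨hb, rfl⟩⟩, ?_⟩
      rintro t' ⟨a', u', h1', h2', ⟨-, rfl⟩ | ⟨h3', -⟩⟩
      · obtain rfl := h1.unique hi h1'
        exact h2'.unique h2
      · exact absurd h3' hb

theorem AllocNode.lt_of_used {i k : ℕ} {p : P} {n : NodePtr} (h : R.AllocNode i p n)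
    (hk : n ∈ (R.conf (k + 1)).sh.usedNodes) : i < k := by
  obtain ⟨m, h1, h2, rfl⟩ := h
  by_contra hik
  exact h2.e3_fresh.1 (R.usedNodes_mono (by have := h1.1; lia) hk)

theorem AllocLoc.lt_of_used {i k : ℕ} {p : P} {a : LocPtr} (h : R.AllocLoc i p a)
    (hk : a ∈ (R.conf (k + 1)).sh.usedLocs) : i < k := by
  obtain ⟨m, h1, h2, rfl⟩ := h
  by_contra hik
  exact h2.d4_fresh.1 (R.usedLocs_mono (by have := h1.1; lia) hk)

theorem GhostRun.within (hG : R.GhostRun G) {o : OpRec P} (ho : o ∈ R.completion) {t : ℕ}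
    (ht : R.LinPoint o t) : R.Within o t := by
  rw [hG.mem_completion_iff] at ho
  obtain ⟨i, p, op, r⟩ := o
  obtain ⟨hi, hr⟩ := ho
  cases op with
  | enq v =>
    obtain ⟨n, h1, h2⟩ := ht
    refine ⟨h1.lt_of_used (h2.1 ▸ hG.tail_used (t + 1)), fun r j hj => ?_⟩
    obtain ⟨-, n', t', h1', h2', h3⟩ := hG.response_enq hi hj
    obtain rfl := h1.unique hi h1'
    rwa [h2.unique h2']
  | deq =>
    obtain ⟨a, u, h1, h2, h3⟩ := ht
    have hu : ∀ r j, R.history.RespondsAt i p r j → u < j := by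
      intro r j hj
      obtain ⟨a', t', h1', h2', -, h3⟩ := hG.response_deq hi hj
      obtain rfl := h1.unique hi h1'
      rwa [h2.unique h2']
    rcases h3 with ⟨-, rfl⟩ | ⟨hb, hl⟩
    · exact ⟨h1.lt_of_used (h2.1 ▸ hG.head_used (t + 1)), hu⟩
    · obtain ⟨a', u', h1', h2', h3'⟩ := hr
      obtain rfl := h1.unique hi h1'
      obtain rfl := h2.unique h2'
      simp only at hb h3'
      rw [hb] at h3'
      obtain ⟨t', q, g1, ⟨⟨e, g2⟩, -⟩, g3, g4, g5, -⟩ :=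
        h2.exists_tailRead hG (by simpa using h3'.symm)
      obtain rfl := hl.unique ⟨q, e, g2, g1, g3, fun m hm hm' => (g4 m hm hm').1⟩
      refine ⟨?_, fun r j hj => g1.trans (hu r j hj)⟩
      -- the serving process knows the location when it reads `g_Tail`
      have hp := (hG.inv t).2 q
      simp only [ProcInv, g3.2] at hp
      refine h1.lt_of_used (R.usedLocs_mono (Nat.le_succ t) ?_)
      exact (hG.inv t).1.readyLoc_used _ (g5 ▸ hp.1.1)

/-! ### The abstract queue -/

/-- The values of the nodes after `g_Head.ptr`, up to `g_Tail`. -/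
def _root_.DNB2Queue.Ghost.queue (s : Shared) (G : Ghost P) : List ℤ :=
  (List.range' (G.headPos + 1) (G.tailPos - G.headPos)).map fun i => (s.node (G.nodeAt i)).value

theorem _root_.DNB2Queue.Evolves.map_value {p : P} {s s' : Shared} {G G' : Ghost P}
    (I : SharedInv s G) (h : Evolves p s G s' G') {i k : ℕ} (hk : i + k ≤ G.tailPos + 1) :
    (List.range' i k).map (fun i => (s'.node (G'.nodeAt i)).value) =
      (List.range' i k).map (fun i => (s.node (G.nodeAt i)).value) := by
  refine List.map_congr_left fun j hj => ?_
  have hj' : j < G.len := by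
    have := (List.mem_range'_1.1 hj).2
    have := I.tail_lt
    lia
  rw [h.nodeAt j hj', h.value _ (I.node_ready j hj')]

/-- The state of the abstract queue at time `t`. -/
def queueAt (R : Run P) (G : ℕ → Ghost P) (t : ℕ) : List ℤ := (G t).queue (R.conf t).sh

theorem FirstTail.queueAt (hG : R.GhostRun G) {n : NodePtr} {t : ℕ} (h : R.FirstTail n t) :
    R.queueAt G (t + 1) = R.queueAt G t ++ [((R.conf (t + 1)).sh.node n).value] := by
  obtain ⟨h1, h2⟩ := h.tailPos hG
  have I := (hG.inv t).1
  have hle := I.head_le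
  rcases hG.stay_or_evolves t with h3 | ⟨p, h3⟩
  · rw [h3.2] at h1; lia
  · have h4 : (G (t + 1)).headPos = (G t).headPos := by
      rcases h3.head with h4 | h4
      · exact h4.2.2
      · have := h4.2.2.1; lia
    unfold Run.queueAt Ghost.queue
    rw [h4, h1, show (G t).tailPos + 1 - (G t).headPos = (G t).tailPos - (G t).headPos + 1 by lia,
      List.range'_1_concat, List.map_append, h3.map_value I (by lia)]
    rw [List.map_singleton, show (G t).headPos + 1 + ((G t).tailPos - (G t).headPos) =
      (G t).tailPos + 1 by lia, h2]

theorem FirstHead.queueAt (hG : R.GhostRun G) {a : LocPtr} {t : ℕ} (h : R.FirstHead a t)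
    (hb : (R.conf (t + 1)).sh.head.value ≠ .bot) :
    ∃ v, (R.conf (t + 1)).sh.head.value = .elem v ∧
      R.queueAt G t = v :: R.queueAt G (t + 1) := by
  obtain ⟨h1, ⟨h2, -⟩ | ⟨h2, h3, h4⟩⟩ := h.change hG
  · exact absurd h2 hb
  · refine ⟨_, h4, ?_⟩
    have I := (hG.inv t).1
    rcases hG.stay_or_evolves t with h5 | ⟨p, h5⟩
    · rw [h5.2] at h2; lia
    · unfold Run.queueAt Ghost.queue
      rw [h1, h2, h5.map_value I (by lia), ← List.map_cons (f := fun i =>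
        ((R.conf t).sh.node ((G t).nodeAt i)).value), ← List.range'_succ]
      congr 2
      lia

theorem GhostRun.queueAt_eq (hG : R.GhostRun G) {t : ℕ}
    (h1 : (G (t + 1)).tailPos = (G t).tailPos) (h2 : (G (t + 1)).headPos = (G t).headPos) :
    R.queueAt G (t + 1) = R.queueAt G t := by
  have I := (hG.inv t).1
  have := I.head_le
  rcases hG.stay_or_evolves t with h5 | ⟨p, h5⟩
  · unfold Run.queueAt; rw [h5.1, h5.2]
  · unfold Run.queueAt Ghost.queue
    rw [h1, h2, h5.map_value I (by lia)]

theorem Executes.td2_shared {t : ℕ} {q : P} (h : R.Executes t q .td2) :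
    (R.conf (t + 1)).sh = (R.conf t).sh := by
  obtain ⟨e, -, hs⟩ := step_of_executes h
  exact hs.shared_eq_of_td2 h.2

theorem GhostRun.queueAt_td2 (hG : R.GhostRun G) {t : ℕ} {q : P} (h : R.Executes t q .td2) :
    R.queueAt G (t + 1) = R.queueAt G t := by
  have hs := h.td2_shared
  have h1 : (G (t + 1)).tailPos = (G t).tailPos := by
    rcases hG.stay_or_evolves t with h5 | ⟨p, h5⟩
    · rw [h5.2]
    · by_contra hne
      have := h5.tail_le
      have := h5.tail_le_succ
      refine (hG.firstTail_of_tailPos (t := t) (by lia)).2 t le_rfl ?_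
      rw [hs]
  refine hG.queueAt_eq h1 ?_
  rcases hG.stay_or_evolves t with h5 | ⟨p, h5⟩
  · rw [h5.2]
  · rcases h5.head with h6 | h6
    · exact h6.2.2
    · rw [hs, (hG.inv t).1.val_head] at h6
      simp at h6

/-- The value of the node of an enqueue is the argument of the enqueue. -/
theorem FirstTail.value (hG : R.GhostRun G) {n : NodePtr} {t i : ℕ} {p : P} {v : ℤ}
    (hi : R.history i = some (p, .inv (.enq v))) (ha : R.AllocNode i p n)
    (h : R.FirstTail n t) : ((R.conf (t + 1)).sh.node n).value = v := by
  have I := (hG.inv (t + 1)).1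
  have hn : n ∈ (G (t + 1)).ready := by
    rw [← h.1, ← I.tail]
    exact I.node_ready _ I.tail_lt
  obtain ⟨k, h1, h2, h3⟩ := ha
  obtain ⟨f1, f2⟩ := h2.e3_fresh
  rw [h3] at f1 f2
  have hk : k + 1 ≤ t + 1 := by
    by_contra hk
    exact f1 (R.usedNodes_mono (by lia) (I.ready_used _ hn))
  refine I.value n hn p v ?_
  rw [hG.owner_mono hk f2]
  obtain ⟨e, he, hs⟩ := step_of_executes h2
  have hpc : ((R.conf (k + 1)).loc p).pc = .e4 := by
    rcases hs.usedNodes with g | g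
    · exact absurd h2.2 g.2
    · exact g.2.1
  have hp := (hG.inv (k + 1)).2 p
  simp only [ProcInv, hpc] at hp
  have ho : R.history.Open i p (k + 1) := by
    refine (open_succ_iff h1.1).2 ⟨h1, fun r hr => ?_⟩
    rcases hs.stage with g | g | g | g | g | g | g
    · have := h2.2; simp [Locals.stage, this] at g
    · have := h2.2; simp [Locals.stage, this] at g
    · exact absurd h2.2 (by rw [g.2.1]; simp)
    · exact absurd h2.2 (by rw [g.2.1]; simp)
    · rw [history_of_act he, g.1] at hr; simp at hr
    · exact absurd h2.2 (by rw [g.2.1]; simp)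
    · exact absurd h2.2 g.2.1
  have hst := StageInv.of_open hi ho
  simp only [StageInv, Locals.stage, hpc, Op.enq.injEq] at hst
  rw [← h3, hp.2.2, hst.1]

/-- The abstract queue changes at the linearization point of an operation as prescribed by the
specification. -/
theorem GhostRun.applyOp_eq (hG : R.GhostRun G) {o : OpRec P} (ho : o ∈ R.completion) {t : ℕ}
    (ht : R.LinPoint o t) : applyOp o.op (R.queueAt G t) = (R.queueAt G (t + 1), o.resp) := by
  rw [hG.mem_completion_iff] at ho
  obtain ⟨i, p, op, r⟩ := o
  obtain ⟨hi, hr⟩ := ho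
  cases op with
  | enq v =>
    obtain ⟨n, h1, h2⟩ := ht
    obtain ⟨-, rfl⟩ := hr
    rw [h2.queueAt hG, h2.value hG hi h1]
    rfl
  | deq =>
    obtain ⟨a, u, h1, h2, h3⟩ := ht
    obtain ⟨a', u', h1', h2', h3'⟩ := hr
    obtain rfl := h1.unique hi h1'
    obtain rfl := h2.unique h2'
    simp only at h3 h3' ⊢
    subst h3'
    simp only [ne_eq, Resp.ret.injEq] at h3
    rcases h3 with ⟨hb, rfl⟩ | ⟨hb, hl⟩
    · obtain ⟨v, hv, hq⟩ := h2.queueAt hG hb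
      rw [hv, hq]
      rfl
    · obtain ⟨t', q, g1, ⟨⟨e, g2⟩, -⟩, g3, g4, -, g5⟩ := h2.exists_tailRead hG hb
      obtain rfl := hl.unique ⟨q, e, g2, g1, g3, fun m hm hm' => (g4 m hm hm').1⟩
      have hq : R.queueAt G t = [] := by simp [Run.queueAt, Ghost.queue, g5]
      rw [hG.queueAt_td2 g3, hq, hb]
      rfl

/-- The abstract queue only changes at linearization points. -/
theorem GhostRun.queueAt_succ (hG : R.GhostRun G) {t : ℕ}
    (h : ∀ o ∈ R.completion, ¬ R.LinPoint o t) : R.queueAt G (t + 1) = R.queueAt G t := by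
  rcases hG.stay_or_evolves t with h5 | ⟨p, h5⟩
  · unfold Run.queueAt; rw [h5.1, h5.2]
  · have h1 : (G (t + 1)).tailPos = (G t).tailPos := by
      by_contra hne
      have := h5.tail_le
      have := h5.tail_le_succ
      have hf := hG.firstTail_of_tailPos (t := t) (by lia)
      -- the initial node is the only one that is used at first
      have h0 : (R.conf (t + 1)).sh.tail ∉ (R.conf 0).sh.usedNodes := by
        obtain ⟨n, a, hi⟩ := R.init
        rw [hi.usedNodes, ← hi.tail, Set.mem_singleton_iff]
        exact (hf.2 0 (Nat.zero_le t)).symm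
      obtain ⟨i, p, v, hi, ha⟩ := exists_allocNode h0 (hG.tail_used (t + 1))
      exact h ⟨i, p, .enq v, .done⟩ (hG.mem_completion_iff.2 ⟨hi, ⟨_, t, ha, hf⟩, rfl⟩) ⟨_, ha, hf⟩
    refine hG.queueAt_eq h1 ?_
    rcases h5.head with h6 | ⟨h6, h7, h8, ⟨-, h9⟩ | ⟨h9, h10, h11⟩⟩
    · exact h6.2.2
    · exact h9
    · have hne : ∀ s ≤ t, (R.conf s).sh.head.addr ≠ (R.conf (t + 1)).sh.head.addr := by
        intro s hs hst
        have := hG.val_mono hs (hG.inv s).1.val_head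
        rw [hst, h6] at this
        simp at this
      have hf : R.FirstHead (R.conf (t + 1)).sh.head.addr t := ⟨rfl, hne⟩
      have h0 : (R.conf (t + 1)).sh.head.addr ∉ (R.conf 0).sh.usedLocs := by
        obtain ⟨n, a, hi⟩ := R.init
        rw [hi.usedLocs, ← hi.head_addr, Set.mem_singleton_iff]
        exact (hne 0 (Nat.zero_le t)).symm
      obtain ⟨i, p, hi, ha⟩ := exists_allocLoc h0 (hG.head_used (t + 1))
      exact absurd ⟨_, t, ha, hf, Or.inl ⟨by simp [h11], rfl⟩⟩
        (h ⟨i, p, .deq, _⟩ (hG.mem_completion_iff.2 ⟨hi, _, t, ha, hf, rfl⟩))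

/-- Distinct operations have distinct linearization points. -/
theorem GhostRun.linPoint_inj (hG : R.GhostRun G) {o o' : OpRec P} (ho : o ∈ R.completion)
    (ho' : o' ∈ R.completion) {t : ℕ} (ht : R.LinPoint o t) (ht' : R.LinPoint o' t) : o = o' := by
  refine hG.completion_unique ho ho' ?_
  rw [hG.mem_completion_iff] at ho ho'
  obtain ⟨i, p, op, r⟩ := o
  obtain ⟨i', p', op', r'⟩ := o'
  obtain ⟨hi, hr⟩ := ho
  obtain ⟨hi', hr'⟩ := ho'
  -- a step that moves `g_Tail` neither changes `g_Head` nor reads `g_Tail` in `trytodequeue`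
  have key : ∀ n a u r, R.FirstTail n t → R.FirstHead a u →
      ((r ≠ Resp.ret .bot ∧ t = u) ∨ (r = Resp.ret .bot ∧ R.LastTailRead u t)) → False := by
    rintro n a u r h1 h2 (⟨-, rfl⟩ | ⟨-, q, e, -, -, h3, -⟩)
    · have := (h1.tailPos hG).1
      have := (h2.change hG).1
      lia
    · refine h1.2 t le_rfl ?_
      rw [← h3.td2_shared, h1.1]
  have key' : ∀ a u, R.FirstHead a t → ¬ R.LastTailRead u t := by
    rintro a u h1 ⟨q, e, -, -, h3, -⟩
    refine h1.2 t le_rfl ?_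
    rw [← h3.td2_shared, h1.1]
  have key'' : ∀ i p r, R.history i = some (p, .inv .deq) → R.AddedResponse i p .deq r → ∀ a u,
      R.AllocLoc i p a → R.FirstHead a u → r = .ret .bot → ∃ q, R.Executes u q .td7 := by
    rintro i p r hi ⟨a', u', h1', h2', h3'⟩ a u h1 h2 rfl
    obtain rfl := h1.unique hi h1'
    obtain rfl := h2.unique h2'
    obtain ⟨-, q, -, g, -⟩ := h2.exists_tailRead hG (by simpa using h3'.symm)
    exact ⟨q, g⟩
  cases op with
  | enq v =>
    obtain ⟨n, h1, h2⟩ := ht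
    cases op' with
    | enq v' =>
      obtain ⟨n', h1', h2'⟩ := ht'
      obtain rfl := h2.1.symm.trans h2'.1
      exact h1.inj hi hi' h1'
    | deq =>
      obtain ⟨a', u', h1', h2', h3'⟩ := ht'
      exact (key _ _ _ _ h2 h2' h3').elim
  | deq =>
    obtain ⟨a, u, h1, h2, h3⟩ := ht
    cases op' with
    | enq v' =>
      obtain ⟨n', h1', h2'⟩ := ht'
      exact (key _ _ _ _ h2' h2 h3).elim
    | deq =>
      obtain ⟨a', u', h1', h2', h3'⟩ := ht'
      have hu : u = u' := by
        rcases h3 with ⟨hb, rfl⟩ | ⟨hb, hl⟩ <;> rcases h3' with ⟨hb', rfl⟩ | ⟨hb', hl'⟩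
        · rfl
        · exact absurd hl' (key' _ _ h2)
        · exact absurd hl (key' _ _ h2')
        · obtain ⟨q, g⟩ := key'' _ _ _ hi hr _ _ h1 h2 hb
          obtain ⟨q', g'⟩ := key'' _ _ _ hi' hr' _ _ h1' h2' hb'
          exact hl.eq_of_td7 hl' g g'
      subst hu
      obtain rfl := h2.1.symm.trans h2'.1
      exact h1.inj hi hi' h1'

/-! ### Linearizability -/

theorem _root_.DNB2Queue.legal_append (q : List ℤ) (l : List (Op × Resp)) (x : Op × Resp) :
    Legal q (l ++ [x]) ↔
      Legal q l ∧ (applyOp x.1 (l.foldl (fun q y => (applyOp y.1 q).1) q)).2 = x.2 := by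
  induction l generalizing q with
  | nil => simp [Legal]
  | cons y l ih => simp [Legal, ih, and_assoc]

/-- The operations before time `N` lead to the state of the abstract queue at time `N`. -/
theorem GhostRun.legal (hG : R.GhostRun G) {L : ℕ → Option (OpRec P)}
    (hL : ∀ t o, L t = some o ↔ o ∈ R.completion ∧ R.LinPoint o t) (N : ℕ) :
    Legal [] (firstOps L N) ∧
      (firstOps L N).foldl (fun q y => (applyOp y.1 q).1) [] = R.queueAt G N := by
  induction N with
  | zero =>
    simp [firstOps, Legal, Run.queueAt, Ghost.queue, hG.tailPos_zero]
  | succ N ih =>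
    rcases hN : L N with _ | o
    · have h1 : firstOps L (N + 1) = firstOps L N := by
        simp [firstOps, List.range_succ, List.filterMap_append, hN]
      rw [h1, hG.queueAt_succ fun o ho ht => by simp [(hL N o).2 ⟨ho, ht⟩] at hN]
      exact ih
    · have h1 : firstOps L (N + 1) = firstOps L N ++ [(o.op, o.resp)] := by
        simp [firstOps, List.range_succ, List.filterMap_append, hN]
      obtain ⟨ho, ht⟩ := (hL N o).1 hN
      have h2 := hG.applyOp_eq ho ht
      rw [h1, legal_append, List.foldl_append, ih.2]
      exact ⟨⟨ih.1, by rw [h2]⟩, by simp [h2]⟩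

theorem GhostRun.isLinearization (hG : R.GhostRun G) {L : ℕ → Option (OpRec P)}
    (hL : ∀ t o, L t = some o ↔ o ∈ R.completion ∧ R.LinPoint o t) :
    IsLinearization R.history R.completion L where
  mem t o h := ((hL t o).1 h).1
  once o ho := by
    obtain ⟨t, ht, hu⟩ := hG.existsUnique_linPoint ho
    exact ⟨t, (hL t o).2 ⟨ho, ht⟩, fun t' ht' => hu t' ((hL t' o).1 ht').2⟩
  realTime o o' t t' r j h h' hr hj := by
    obtain ⟨ho, ht⟩ := (hL t o).1 h
    obtain ⟨ho', ht'⟩ := (hL t' o').1 h'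
    exact (((hG.within ho ht).2 r j hr).trans hj).trans (hG.within ho' ht').1
  legal N := (hG.legal hL N).1

end Run
end DNB2Queue

theorem mainTheorem1 {P : Type*} (R : Run P) :
    Linearizable R.history ∧
    IsCompletion R.history R.completion ∧
    (∀ o ∈ R.completion, ∃! t, R.LinPoint o t) ∧
    (∀ o ∈ R.completion, ∀ t, R.LinPoint o t → R.Within o t) ∧
    ∃ L : ℕ → Option (OpRec P),
      (∀ t o, L t = some o ↔ o ∈ R.completion ∧ R.LinPoint o t) ∧
      IsLinearization R.history R.completion L := by
  classical
  obtain ⟨G, hG⟩ := R.exists_ghostRun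
  let L : ℕ → Option (OpRec P) := fun t =>
    if h : ∃ o, o ∈ R.completion ∧ R.LinPoint o t then some h.choose else none
  have hL : ∀ t o, L t = some o ↔ o ∈ R.completion ∧ R.LinPoint o t := by
    intro t o
    simp only [L]
    split_ifs with h
    · have hc := h.choose_spec
      rw [Option.some.injEq]
      constructor
      · rintro rfl
        exact hc
      · rintro ⟨h1, h2⟩
        exact hG.linPoint_inj hc.1 h1 hc.2 h2
    · simp only [false_iff]
      exact fun ho => h ⟨o, ho⟩
  have hlin := hG.isLinearization hL
  exact ⟨⟨_, L, hG.isCompletion, hlin⟩, hG.isCompletion, fun o ho => hG.existsUnique_linPoint ho,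
    fun o ho t ht => hG.within ho ht, L, hL, hlin⟩
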